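/- Let $n\ge 2$, $k\in\mathbb Z_{\ge 0}$, $0<\alpha\le 1$. Let $D_1,\dots,D_n\subset\mathbb C$ be bounded domains with $C^{k+1,\alpha}$ boundary, i.e. $\partial D_j$ is a finite union of pairwise disjoint Jordan curves with regular $C^{k+1,\alpha}$ parametrizations, each having $D_j$ locally on exactly one side; orient $\partial D_j$ positively, so that $D_j$ lies to its left. Put $\Omega=D_1\times\cdots\times D_n$. Let $C^{m,\alpha}(\Omega)$ be the space of functions of class $C^m$ on $\Omega$ whose derivatives of order at most $m$ are bounded and whose derivatives of order $m$ are $\alpha$-Hölder continuous on $\Omega$. For a function $g$ on $\Omega$ and $z\in\Omega$ set $$T_jg(z)=-\frac1{2\pi i}\int_{D_j}\frac{g(z_1,\dots,z_{j-1},\zeta,z_{j+1},\dots,z_n)}{\zeta-z_j}\,d\bar\zeta\wedge d\zeta,\qquad S_jg(z)=\frac1{2\pi i}\int_{\partial D_j}\frac{g(z_1,\dots,z_{j-1},\zeta,z_{j+1},\dots,z_n)}{\zeta-z_j}\,d\zeta,$$ where in $S_j$ the values of $g$ at $\zeta\in\partial D_j$ are the limits from inside $D_j$, the other variables being fixed.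 Let $\mathbf f=\sum_{j=1}^n f_j\,d\bar z_j$ be a $(0,1)$ form, not necessarily $\bar\partial$-closed, with all $f_j\in C^{n-1,\alpha}(\Omega)$, and put $$T\mathbf f=\sum_{j=1}^n T_jS_1\cdots S_{j-1}f_j,\qquad T^*\mathbf f=\sum_{s=1}^n(-1)^{s-1}\sum_{1\le i_1<\cdots<i_s\le n}T_{i_1}\cdots T_{i_s}\Big(\frac{\partial^{s-1}f_{i_s}}{\partial\bar z_{i_1}\cdots\partial\bar z_{i_{s-1}}}\Big).$$ Then all boundary values occurring in $T\mathbf f$ exist, all integrals occurring in $T\mathbf f$ and $T^*\mathbf f$ converge absolutely, and $T^*\mathbf f=T\mathbf f$ on $\Omega$. -/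

import Mathlib

open Set Filter Topology MeasureTheory

noncomputable section

/-- `f` belongs to the Hölder space `C^{k,α}(U)`, `U` open: `f` is of class `C^k` on `U`, its
derivatives of order at most `k` are bounded on `U`, and those of order `k` are `α`-Hölder. -/
def MemHolderSpace {E F : Type*} [NormedAddCommGroup E] [NormedSpace ℝ E]
    [NormedAddCommGroup F] [NormedSpace ℝ F] (k : ℕ) (α : ℝ) (U : Set E) (f : E → F) : Prop :=
  ContDiffOn ℝ k f U ∧
  (∀ m ≤ k, ∃ C : ℝ, ∀ x ∈ U, ‖iteratedFDeriv ℝ m f x‖ ≤ C) ∧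
  ∃ C : ℝ, ∀ x ∈ U, ∀ y ∈ U,
    ‖iteratedFDeriv ℝ k f x - iteratedFDeriv ℝ k f y‖ ≤ C * ‖x - y‖ ^ α

/-- A positively oriented parametrization of the boundary of a planar set `D` with boundary of
class `C^{m,α}` (used with `m ≥ 1`): `∂D` is the union of finitely many pairwise disjoint Jordan
curves with regular `C^{m,α}` parametrizations, of period `1`, and `D` lies to the left of each
of them and only there (`I * γ'` is the left normal). -/
structure PositiveBoundary (m : ℕ) (α : ℝ) (D : Set ℂ) where
  /-- the number of boundary curves -/
  N : ℕ
  /-- the boundary curves -/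
  curve : Fin N → ℝ → ℂ
  regularity : ∀ c, MemHolderSpace m α univ (curve c)
  periodic : ∀ c, Function.Periodic (curve c) 1
  injOn : ∀ c, InjOn (curve c) (Ico 0 1)
  deriv_ne_zero : ∀ c t, deriv (curve c) t ≠ 0
  disjoint : Pairwise fun c c' => Disjoint (range (curve c)) (range (curve c'))
  iUnion_range : ⋃ c, range (curve c) = frontier D
  left_mem : ∀ c t, ∀ᶠ ε : ℝ in 𝓝[>] 0,
    curve c t + (ε : ℂ) * (Complex.I * deriv (curve c) t) ∈ D
  right_notMem : ∀ c t, ∀ᶠ ε : ℝ in 𝓝[>] 0,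
    curve c t - (ε : ℂ) * (Complex.I * deriv (curve c) t) ∉ closure D

/-- The contour integral `∫_{∂D} g(ζ) dζ`. -/
def PositiveBoundary.contourIntegral {m : ℕ} {α : ℝ} {D : Set ℂ} (B : PositiveBoundary m α D)
    (g : ℂ → ℂ) : ℂ :=
  ∑ c, ∫ t in (0 : ℝ)..1, g (B.curve c t) * deriv (B.curve c) t

/-- The function `ζ ↦ g(z₁, …, ζ, …, z_n)` (`ζ` in the `j`-th place) for `ζ` in the closure of
`D_j`: its value at a boundary point of `D_j` is the limit from inside `D_j`. -/
def sliceExt {n : ℕ} (D : Fin n → Set ℂ) (j : Fin n) (g : (Fin n → ℂ) → ℂ) (z : Fin n → ℂ) :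
    ℂ → ℂ :=
  extendFrom (D j) fun ζ => g (Function.update z j ζ)

/-- The solid Cauchy transform in the `j`-th variable,
`T_j g(z) = -(2πi)⁻¹ ∫_{D_j} g(z₁, …, ζ, …, z_n) / (ζ - z_j) dζ̄ ∧ dζ`,
where `dζ̄ ∧ dζ` is `2i` times Lebesgue measure. -/
def solidCauchy {n : ℕ} (D : Fin n → Set ℂ) (j : Fin n) (g : (Fin n → ℂ) → ℂ) :
    (Fin n → ℂ) → ℂ := fun z =>
  -(1 / (2 * Real.pi * Complex.I)) *
    ∫ ζ in D j, g (Function.update z j ζ) / (ζ - z j) * (2 * Complex.I)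

/-- The boundary Cauchy transform in the `j`-th variable,
`S_j g(z) = (2πi)⁻¹ ∫_{∂D_j} g(z₁, …, ζ, …, z_n) / (ζ - z_j) dζ`. -/
def boundaryCauchy {n m : ℕ} {α : ℝ} {D : Fin n → Set ℂ}
    (B : ∀ j, PositiveBoundary m α (D j)) (j : Fin n) (g : (Fin n → ℂ) → ℂ) :
    (Fin n → ℂ) → ℂ := fun z =>
  1 / (2 * Real.pi * Complex.I) *
    (B j).contourIntegral fun ζ => sliceExt D j g z ζ / (ζ - z j)

/-- The Wirtinger derivative `∂g/∂z̄_j`. -/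
def dbar {n : ℕ} (j : Fin n) (g : (Fin n → ℂ) → ℂ) : (Fin n → ℂ) → ℂ := fun z =>
  1 / 2 * (fderiv ℝ g z (Pi.single j 1) + Complex.I * fderiv ℝ g z (Pi.single j Complex.I))

/-- `A_{i₁} ⋯ A_{i_s} g = A_{i₁}(A_{i₂}(⋯ A_{i_s} g))` for a family of operators `A` and a list
`[i₁, …, i_s]` of indices. -/
def iterOp {ι X : Type*} (A : ι → X → X) (L : List ι) (g : X) : X :=
  L.foldr A g

/-- The list of all indices before `j`, in increasing order. -/
def indicesBelow {n : ℕ} (j : Fin n) : List (Fin n) :=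
  List.ofFn fun l : Fin (j : ℕ) => l.castLE j.isLt.le

/-- `T 𝐟 = ∑_j T_j S_1 ⋯ S_{j-1} f_j`. -/
def solutionOp {n m : ℕ} {α : ℝ} {D : Fin n → Set ℂ} (B : ∀ j, PositiveBoundary m α (D j))
    (f : Fin n → (Fin n → ℂ) → ℂ) : (Fin n → ℂ) → ℂ := fun z =>
  ∑ j, solidCauchy D j (iterOp (boundaryCauchy B) (indicesBelow j) (f j)) z

/-- `∂^{s-1} f_{i_s} / ∂z̄_{i₁} ⋯ ∂z̄_{i_{s-1}}`, where `s = r + 1`. -/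
def mixedDbar {n r : ℕ} (i : Fin (r + 1) → Fin n) (f : Fin n → (Fin n → ℂ) → ℂ) :
    (Fin n → ℂ) → ℂ :=
  iterOp dbar (List.ofFn fun a : Fin r => i a.castSucc) (f (i (Fin.last r)))

open Classical in
/-- `T* 𝐟 = ∑_{s=1}^n (-1)^{s-1} ∑_{i₁ < ⋯ < i_s}
T_{i₁} ⋯ T_{i_s} (∂^{s-1} f_{i_s} / ∂z̄_{i₁} ⋯ ∂z̄_{i_{s-1}})`; here `s = r + 1`. -/
def solutionOpStar {n : ℕ} (D : Fin n → Set ℂ) (f : Fin n → (Fin n → ℂ) → ℂ) :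
    (Fin n → ℂ) → ℂ := fun z =>
  ∑ r ∈ Finset.range n, (-1) ^ r *
    ∑ i ∈ (Finset.univ : Finset (Fin (r + 1) → Fin n)).filter StrictMono,
      iterOp (solidCauchy D) (List.ofFn i) (mixedDbar i f) z

/-- The integral defining `T_j g` converges absolutely at every point of the product domain. -/
def SolidCauchyConverges {n : ℕ} (D : Fin n → Set ℂ) (j : Fin n) (g : (Fin n → ℂ) → ℂ) : Prop :=
  ∀ z ∈ univ.pi D, IntegrableOn (fun ζ => g (Function.update z j ζ) / (ζ - z j)) (D j)

/-- At every point of the product domain, the boundary values entering `S_j g` exist and the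
integral defining `S_j g` converges absolutely. -/
def BoundaryCauchyConverges {n m : ℕ} {α : ℝ} {D : Fin n → Set ℂ}
    (B : ∀ j, PositiveBoundary m α (D j)) (j : Fin n) (g : (Fin n → ℂ) → ℂ) : Prop :=
  ∀ z ∈ univ.pi D,
    (∀ ζ ∈ frontier (D j), ∃ a, Tendsto (fun w => g (Function.update z j w)) (𝓝[D j] ζ) (𝓝 a)) ∧
    ∀ c, IntervalIntegrable (fun t => sliceExt D j g z ((B j).curve c t) /
      ((B j).curve c t - z j) * deriv ((B j).curve c) t) volume 0 1

end

/-!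
In one variable, the Cauchy–Pompeiu formula says that `S_l g = g - T_l ∂̄_l g`. Since `∂̄_l`
commutes with `T_i` for `i ≠ l` (differentiation under the integral sign), multiplying out gives
`S_1 ⋯ S_{j-1} f_j = ∑ (-1)^s T_{i₁} ⋯ T_{i_s} ∂̄_{i₁} ⋯ ∂̄_{i_s} f_j`, the sum being over all
`i₁ < ⋯ < i_s < j` (`iterOp_boundaryCauchy_eqOn`). The operator `T_j` moves past the other
transforms by Fubini's theorem (`solidCauchy_iterOp_comm`), and summing over `j` gives `T* 𝐟`, as
an increasing sequence of indices is its last term `j` together with the terms below `j`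
(`sum_strictMono_eq_sum_sublists`). The integrals converge and the boundary values exist because
the solid transforms preserve bounded continuous functions (`BddContOn.solidCauchy`) and bounded
first derivatives in the variables not integrated over (`HasSliceWirtinger.solidCauchy`).

The analytic core is the Cauchy–Pompeiu formula on a domain with `C¹` boundary
(`PositiveBoundary.pompeiuFormula`). Near a boundary point there are `C¹` coordinates, linear in the
normal direction, in which the boundary is the real axis and the domain is the upper half of a
square (`PositiveBoundary.nonempty_collar`). In these coordinates a function with bounded
derivatives is Lipschitz, hence has boundary values, and Green's formula for functions supported
there reduces to the fundamental theorem of calculus along coordinate lines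
(`PositiveBoundary.Collar.green`). For functions with compact support in the domain, the formula is
a computation in polar coordinates (`integral_dbar_div_sub`). A partition of unity combines the two.
-/

noncomputable section

/-! ### Bounded continuous functions and the Cauchy kernel -/

/-- The function `g` is continuous and bounded on `s`. -/
def BddContOn {X : Type*} [TopologicalSpace X] (s : Set X) (g : X → ℂ) : Prop :=
  ContinuousOn g s ∧ ∃ C : ℝ, ∀ x ∈ s, ‖g x‖ ≤ C

namespace BddContOn

variable {X Y : Type*} [TopologicalSpace X] [TopologicalSpace Y] {s : Set X} {g h : X → ℂ}

theorem exists_nonneg_bound (hg : BddContOn s g) : ∃ C : ℝ, 0 ≤ C ∧ ∀ x ∈ s, ‖g x‖ ≤ C := by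
  obtain ⟨C, hC⟩ := hg.2
  exact ⟨max C 0, le_max_right _ _, fun x hx => (hC x hx).trans (le_max_left _ _)⟩

theorem const (c : ℂ) : BddContOn s fun _ => c :=
  ⟨continuousOn_const, ‖c‖, fun _ _ => le_rfl⟩

theorem congr (hg : BddContOn s g) (h_eq : EqOn h g s) : BddContOn s h := by
  obtain ⟨C, hC⟩ := hg.2
  exact ⟨hg.1.congr h_eq, C, fun x hx => by rw [h_eq hx]; exact hC x hx⟩

theorem add (hg : BddContOn s g) (hh : BddContOn s h) : BddContOn s fun x => g x + h x := by
  obtain ⟨C, hC⟩ := hg.2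
  obtain ⟨C', hC'⟩ := hh.2
  exact ⟨hg.1.add hh.1, C + C', fun x hx =>
    (norm_add_le _ _).trans (add_le_add (hC x hx) (hC' x hx))⟩

theorem mul (hg : BddContOn s g) (hh : BddContOn s h) : BddContOn s fun x => g x * h x := by
  obtain ⟨C, hC0, hC⟩ := hg.exists_nonneg_bound
  obtain ⟨C', hC'⟩ := hh.2
  refine ⟨hg.1.mul hh.1, C * C', fun x hx => ?_⟩
  rw [norm_mul]
  exact mul_le_mul (hC x hx) (hC' x hx) (norm_nonneg _) hC0

theorem const_mul (c : ℂ) (hg : BddContOn s g) : BddContOn s fun x => c * g x :=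
  (const c).mul hg

theorem comp {t : Set Y} {φ : Y → X} (hg : BddContOn s g) (hφ : ContinuousOn φ t)
    (hm : MapsTo φ t s) : BddContOn t fun y => g (φ y) := by
  obtain ⟨C, hC⟩ := hg.2
  exact ⟨hg.1.comp hφ hm, C, fun y hy => hC _ (hm hy)⟩

theorem mono {t : Set X} (hg : BddContOn s g) (hts : t ⊆ s) : BddContOn t g := by
  obtain ⟨C, hC⟩ := hg.2
  exact ⟨hg.1.mono hts, C, fun y hy => hC _ (hts hy)⟩

theorem sum {ι : Type*} (t : Finset ι) {G : ι → X → ℂ} (hG : ∀ i ∈ t, BddContOn s (G i)) :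
    BddContOn s fun x => ∑ i ∈ t, G i x := by
  classical
  induction t using Finset.induction_on with
  | empty => simpa using const (s := s) 0
  | insert i t hi ih =>
    simp only [Finset.sum_insert hi]
    exact (hG i (by simp)).add (ih fun j hj => hG j (by simp [hj]))

theorem integrableOn [MeasurableSpace X] [OpensMeasurableSpace X] {μ : Measure X}
    (hg : BddContOn s g) (hs : MeasurableSet s) (hμ : μ s ≠ ⊤) : IntegrableOn g s μ := by
  obtain ⟨C, hC⟩ := hg.2
  have : IsFiniteMeasure (μ.restrict s) := ⟨by simpa using hμ.lt_top⟩
  exact Integrable.of_bound (hg.1.aestronglyMeasurable hs) C ((ae_restrict_mem hs).mono hC)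

theorem of_continuous {U : Set ℂ} {g : ℂ → ℂ} (hg : Continuous g) (hU : Bornology.IsBounded U) :
    BddContOn U g := by
  obtain ⟨C, hC⟩ := hU.isCompact_closure.exists_bound_of_continuousOn hg.continuousOn
  exact ⟨hg.continuousOn, C, fun x hx => hC x (subset_closure hx)⟩

/-- A function that vanishes on the open set `W` need only be controlled on an open set `V` that
covers the rest. -/
theorem of_cover {V W : Set X} (hV : IsOpen V) (hW : IsOpen W) (hVW : V ∪ W = univ)
    (hg : BddContOn (s ∩ V) g) (h0 : ∀ x ∈ s ∩ W, g x = 0) : BddContOn s g := by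
  obtain ⟨C, hC0, hC⟩ := hg.exists_nonneg_bound
  refine ⟨fun x hx => ?_, C, fun x hx => ?_⟩
  · rcases hVW.ge (mem_univ x) with h | h
    · exact (continuousWithinAt_inter (hV.mem_nhds h)).1 (hg.1 x ⟨hx, h⟩)
    · rw [ContinuousWithinAt, h0 x ⟨hx, h⟩]
      refine tendsto_const_nhds.congr' ?_
      filter_upwards [nhdsWithin_le_nhds (hW.mem_nhds h), eventually_mem_nhdsWithin] with y h1 h2
      exact (h0 y ⟨h2, h1⟩).symm
  · rcases hVW.ge (mem_univ x) with h | h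
    · exact hC x ⟨hx, h⟩
    · rw [h0 x ⟨hx, h⟩, norm_zero]
      exact hC0

end BddContOn

/-- The Cauchy kernel is integrable over discs centred at the pole, because the singularity is of
order one and the plane has dimension two. -/
theorem integrableOn_inv_ball (r : ℝ) : IntegrableOn (fun w : ℂ => w⁻¹) (Metric.ball 0 r) := by
  refine integrableOn_ball_of_norm_le_rpow (C := 1) (α := 1) ?_ ?_ ?_ ?_
  · simp
  · simp
  · exact Eventually.of_forall fun w => by simp [Real.rpow_neg_one]
  · exact (measurable_inv).aestronglyMeasurable

theorem integrableOn_inv_sub {U : Set ℂ} (hU : Bornology.IsBounded U) (z : ℂ) :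
    IntegrableOn (fun ζ : ℂ => (ζ - z)⁻¹) U := by
  obtain ⟨r, hr⟩ := hU.subset_ball z
  refine IntegrableOn.mono_set ?_ hr
  have h := (measurePreserving_sub_right (volume : Measure ℂ) z).integrableOn_comp_preimage
    (measurableEmbedding_subRight z) (f := fun w : ℂ => w⁻¹) (s := Metric.ball 0 r)
  have hpre : (fun x : ℂ => x - z) ⁻¹' Metric.ball 0 r = Metric.ball z r := by
    ext x; simp [dist_eq_norm]
  rw [hpre] at h
  exact h.2 (integrableOn_inv_ball r)

theorem BddContOn.integrableOn_div_sub {U : Set ℂ} {h : ℂ → ℂ} (hh : BddContOn U h)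
    (hUo : IsOpen U) (hU : Bornology.IsBounded U) (z : ℂ) :
    IntegrableOn (fun ζ => h ζ / (ζ - z)) U := by
  obtain ⟨C, hC⟩ := hh.2
  simp only [div_eq_mul_inv]
  exact (integrableOn_inv_sub hU z).bdd_mul (c := C)
    (hh.1.aestronglyMeasurable hUo.measurableSet)
    ((ae_restrict_mem hUo.measurableSet).mono hC)

/-! ### Wirtinger derivatives in one variable -/

/-- The real-linear map `h ↦ a h + b h̄`: the differential of a function with Wirtinger derivatives
`∂u = a` and `∂̄u = b`. -/
def wirtinger (a b : ℂ) : ℂ →L[ℝ] ℂ :=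
  a • ContinuousLinearMap.id ℝ ℂ + b • (Complex.conjCLE : ℂ →L[ℝ] ℂ)

@[simp]
theorem wirtinger_apply (a b h : ℂ) : wirtinger a b h = a * h + b * starRingEnd ℂ h := by
  simp [wirtinger]

/-- The coefficient of `h̄` in `h ↦ a h + b h̄` is determined by the map. -/
theorem right_eq_of_wirtinger_eq {a b a' b' : ℂ} (h : wirtinger a b = wirtinger a' b') :
    b = b' := by
  have h1 := DFunLike.congr_fun h 1
  have h2 := DFunLike.congr_fun h Complex.I
  simp only [wirtinger_apply, map_one, mul_one, Complex.conj_I] at h1 h2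
  have h3 : Complex.I * (a - b) = Complex.I * (a' - b') := by linear_combination h2
  have h4 := mul_left_cancel₀ Complex.I_ne_zero h3
  linear_combination (h1 - h4) / 2

theorem eq_wirtinger (L : ℂ →L[ℝ] ℂ) :
    L = wirtinger (1 / 2 * (L 1 - Complex.I * L Complex.I))
      (1 / 2 * (L 1 + Complex.I * L Complex.I)) := by
  ext h
  have hh : h = h.re • (1 : ℂ) + h.im • Complex.I := by simp
  have hL : L h = h.re * L 1 + h.im * L Complex.I := by
    conv_lhs => rw [hh, map_add, map_smul, map_smul]
    simp
  have hc : starRingEnd ℂ h = h.re - h.im * Complex.I := by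
    apply Complex.ext <;> simp
  have hh' : h = h.re + h.im * Complex.I := by simp
  rw [wirtinger_apply, hL, hc]
  nth_rw 3 [hh']
  linear_combination (h.im * L Complex.I) * Complex.I_sq

/-- On `U` the function `u` is of class `C¹` with Wirtinger derivatives `∂u = a` and `∂̄u = b`, and
`u`, `a`, `b` are bounded. -/
structure HasWirtingerOn (U : Set ℂ) (u a b : ℂ → ℂ) : Prop where
  bddCont : BddContOn U u
  bddCont_d : BddContOn U a
  bddCont_dbar : BddContOn U b
  hasFDerivAt : ∀ ζ ∈ U, HasFDerivAt u (wirtinger (a ζ) (b ζ)) ζ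

namespace HasWirtingerOn

variable {U : Set ℂ} {u a b v a' b' : ℂ → ℂ}

theorem mul (hu : HasWirtingerOn U u a b) (hv : HasWirtingerOn U v a' b') :
    HasWirtingerOn U (fun ζ => u ζ * v ζ) (fun ζ => u ζ * a' ζ + v ζ * a ζ)
      (fun ζ => u ζ * b' ζ + v ζ * b ζ) where
  bddCont := hu.bddCont.mul hv.bddCont
  bddCont_d := (hu.bddCont.mul hv.bddCont_d).add (hv.bddCont.mul hu.bddCont_d)
  bddCont_dbar := (hu.bddCont.mul hv.bddCont_dbar).add (hv.bddCont.mul hu.bddCont_dbar)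
  hasFDerivAt ζ hζ := by
    refine ((hu.hasFDerivAt ζ hζ).mul (hv.hasFDerivAt ζ hζ)).congr_fderiv ?_
    ext h
    simp
    ring

theorem mono {V : Set ℂ} (hu : HasWirtingerOn U u a b) (hV : V ⊆ U) : HasWirtingerOn V u a b where
  bddCont := hu.bddCont.mono hV
  bddCont_d := hu.bddCont_d.mono hV
  bddCont_dbar := hu.bddCont_dbar.mono hV
  hasFDerivAt ζ hζ := hu.hasFDerivAt ζ (hV hζ)

theorem congr (hU : IsOpen U) (hu : HasWirtingerOn U u a b) (h : EqOn v u U) (ha : EqOn a' a U)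
    (hb : EqOn b' b U) : HasWirtingerOn U v a' b' where
  bddCont := hu.bddCont.congr h
  bddCont_d := hu.bddCont_d.congr ha
  bddCont_dbar := hu.bddCont_dbar.congr hb
  hasFDerivAt ζ hζ := by
    rw [ha hζ, hb hζ]
    exact (hu.hasFDerivAt ζ hζ).congr_of_eventuallyEq (eventually_of_mem (hU.mem_nhds hζ) h)

theorem of_cover {V W : Set ℂ} (hU : IsOpen U) (hV : IsOpen V) (hW : IsOpen W)
    (hVW : V ∪ W = univ) (hu : HasWirtingerOn (U ∩ V) u a b) (hu0 : ∀ ζ ∈ U ∩ W, u ζ = 0)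
    (ha0 : ∀ ζ ∈ U ∩ W, a ζ = 0) (hb0 : ∀ ζ ∈ U ∩ W, b ζ = 0) : HasWirtingerOn U u a b where
  bddCont := hu.bddCont.of_cover hV hW hVW hu0
  bddCont_d := hu.bddCont_d.of_cover hV hW hVW ha0
  bddCont_dbar := hu.bddCont_dbar.of_cover hV hW hVW hb0
  hasFDerivAt ζ hζ := by
    rcases hVW.ge (mem_univ ζ) with h | h
    · exact hu.hasFDerivAt ζ ⟨hζ, h⟩
    · have h1 : wirtinger (a ζ) (b ζ) = 0 := by
        rw [ha0 ζ ⟨hζ, h⟩, hb0 ζ ⟨hζ, h⟩]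
        ext h
        simp
      rw [h1]
      exact (hasFDerivAt_const (0 : ℂ) ζ).congr_of_eventuallyEq
        (eventually_of_mem ((hU.inter hW).mem_nhds ⟨hζ, h⟩) hu0)

/-- `∂̄u` is determined by the values of `u` on the open set. -/
theorem dbar_eqOn (hU : IsOpen U) (hu : HasWirtingerOn U u a b) (hv : HasWirtingerOn U v a' b')
    (h : EqOn u v U) : EqOn b b' U := fun ζ hζ => by
  have h1 : HasFDerivAt v (wirtinger (a ζ) (b ζ)) ζ :=
    (hu.hasFDerivAt ζ hζ).congr_of_eventuallyEq
      ((eventually_of_mem (hU.mem_nhds hζ) h).mono fun _ hx => hx.symm)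
  exact right_eq_of_wirtinger_eq (h1.unique (hv.hasFDerivAt ζ hζ))

theorem sum {ι : Type*} (t : Finset ι) {u a b : ι → ℂ → ℂ}
    (h : ∀ i ∈ t, HasWirtingerOn U (u i) (a i) (b i)) :
    HasWirtingerOn U (fun ζ => ∑ i ∈ t, u i ζ) (fun ζ => ∑ i ∈ t, a i ζ)
      (fun ζ => ∑ i ∈ t, b i ζ) where
  bddCont := BddContOn.sum t fun i hi => (h i hi).bddCont
  bddCont_d := BddContOn.sum t fun i hi => (h i hi).bddCont_d
  bddCont_dbar := BddContOn.sum t fun i hi => (h i hi).bddCont_dbar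
  hasFDerivAt ζ hζ := by
    refine (HasFDerivAt.fun_sum fun i hi => (h i hi).hasFDerivAt ζ hζ).congr_fderiv ?_
    ext h
    simp [Finset.sum_add_distrib, Finset.sum_mul]

/-- Where `u` vanishes locally, so does `∂̄u`. -/
theorem dbar_eq_zero (hu : HasWirtingerOn U u a b) {ζ : ℂ} (hζ : ζ ∈ U)
    (h : u =ᶠ[𝓝 ζ] fun _ => 0) : b ζ = 0 := by
  have h1 : HasFDerivAt u (wirtinger 0 0) ζ := by
    have : wirtinger 0 0 = 0 := by ext h; simp
    rw [this]
    exact (hasFDerivAt_const (0 : ℂ) ζ).congr_of_eventuallyEq h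
  exact right_eq_of_wirtinger_eq ((hu.hasFDerivAt ζ hζ).unique h1)

/-- Where `u` vanishes locally, so does `∂u`. -/
theorem d_eq_zero (hu : HasWirtingerOn U u a b) {ζ : ℂ} (hζ : ζ ∈ U)
    (h : u =ᶠ[𝓝 ζ] fun _ => 0) : a ζ = 0 := by
  have h1 : HasFDerivAt (𝕜 := ℝ) u 0 ζ := (hasFDerivAt_const (0 : ℂ) ζ).congr_of_eventuallyEq h
  have h2 := DFunLike.congr_fun ((hu.hasFDerivAt ζ hζ).unique h1) 1
  simpa [hu.dbar_eq_zero hζ h] using h2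

end HasWirtingerOn

/-- A `C¹` function on the plane has bounded Wirtinger derivatives on bounded sets. -/
theorem exists_hasWirtingerOn_of_contDiff {χ : ℂ → ℂ} (hχ : ContDiff ℝ 1 χ) {U : Set ℂ}
    (hU : Bornology.IsBounded U) : ∃ a b, HasWirtingerOn U χ a b := by
  have hd : ∀ c : ℂ, BddContOn U fun ζ => fderiv ℝ χ ζ c := fun c =>
    .of_continuous ((hχ.continuous_fderiv one_ne_zero).clm_apply continuous_const) hU
  refine ⟨fun ζ => 1 / 2 * (fderiv ℝ χ ζ 1 + -Complex.I * fderiv ℝ χ ζ Complex.I),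
    fun ζ => 1 / 2 * (fderiv ℝ χ ζ 1 + Complex.I * fderiv ℝ χ ζ Complex.I),
    .of_continuous hχ.continuous hU, ((hd 1).add ((hd Complex.I).const_mul _)).const_mul _,
    ((hd 1).add ((hd Complex.I).const_mul _)).const_mul _, fun ζ _ => ?_⟩
  have h := (hχ.differentiable one_ne_zero ζ).hasFDerivAt
  rwa [eq_wirtinger (fderiv ℝ χ ζ), sub_eq_add_neg, ← neg_mul] at h

/-! ### The solid Cauchy transform on a product domain -/

section SolidCauchy

variable {n : ℕ} {D : Fin n → Set ℂ}

theorem update_mem_pi {z : Fin n → ℂ} (hz : z ∈ univ.pi D) {j : Fin n} {ζ : ℂ} (hζ : ζ ∈ D j) :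
    Function.update z j ζ ∈ univ.pi D := fun i _ => by
  rcases eq_or_ne i j with rfl | h
  · simpa using hζ
  · simpa [h] using hz i trivial

theorem continuous_update_right (z : Fin n → ℂ) (j : Fin n) : Continuous (Function.update z j) :=
  (continuous_const (y := z)).update (f := fun _ : ℂ => z) j continuous_id

theorem BddContOn.slice {g : (Fin n → ℂ) → ℂ} (hg : BddContOn (univ.pi D) g) {z : Fin n → ℂ}
    (hz : z ∈ univ.pi D) (j : Fin n) : BddContOn (D j) fun ζ => g (Function.update z j ζ) :=
  hg.comp (continuous_update_right z j).continuousOn fun _ hζ => update_mem_pi hz hζ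

theorem BddContOn.solidCauchyConverges (hDo : ∀ j, IsOpen (D j))
    (hDb : ∀ j, Bornology.IsBounded (D j)) {g : (Fin n → ℂ) → ℂ} (hg : BddContOn (univ.pi D) g)
    (j : Fin n) : SolidCauchyConverges D j g := fun z hz =>
  (hg.slice hz j).integrableOn_div_sub (hDo j) (hDb j) (z j)

theorem solidCauchy_congr (hDo : ∀ j, IsOpen (D j)) {g h : (Fin n → ℂ) → ℂ}
    (hgh : EqOn g h (univ.pi D)) (j : Fin n) :
    EqOn (solidCauchy D j g) (solidCauchy D j h) (univ.pi D) := fun z hz => by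
  unfold solidCauchy
  congr 1
  refine setIntegral_congr_fun (hDo j).measurableSet fun ζ hζ => ?_
  simp only [hgh (update_mem_pi hz hζ)]

/-- The solid Cauchy transform is linear on bounded continuous functions. -/
theorem solidCauchy_sum (hDo : ∀ j, IsOpen (D j)) (hDb : ∀ j, Bornology.IsBounded (D j))
    {ι : Type*} (t : Finset ι) (c : ι → ℂ) {G : ι → (Fin n → ℂ) → ℂ}
    (hG : ∀ i ∈ t, BddContOn (univ.pi D) (G i)) (j : Fin n) {z : Fin n → ℂ} (hz : z ∈ univ.pi D) :
    solidCauchy D j (fun z => ∑ i ∈ t, c i * G i z) z = ∑ i ∈ t, c i * solidCauchy D j (G i) z := by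
  unfold solidCauchy
  have h1 : ∀ ζ, (∑ i ∈ t, c i * G i (Function.update z j ζ)) / (ζ - z j) * (2 * Complex.I) =
      ∑ i ∈ t, c i * (G i (Function.update z j ζ) / (ζ - z j) * (2 * Complex.I)) := fun ζ => by
    rw [Finset.sum_div, Finset.sum_mul]
    exact Finset.sum_congr rfl fun i _ => by ring
  simp_rw [h1]
  rw [integral_finsetSum t fun i hi => (((hG i hi).slice hz j).integrableOn_div_sub (hDo j)
    (hDb j) (z j)).mul_const _ |>.const_mul _, Finset.mul_sum]
  refine Finset.sum_congr rfl fun i _ => ?_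
  rw [integral_const_mul]
  ring

/-- The integrand of the solid Cauchy transform after translating the pole to the origin, extended
by zero. -/
def shiftedIntegrand (D : Fin n → Set ℂ) (i : Fin n) (g : (Fin n → ℂ) → ℂ) (z : Fin n → ℂ) :
    ℂ → ℂ :=
  indicator {w | z i + w ∈ D i} fun w => g (Function.update z i (z i + w)) / w * (2 * Complex.I)

theorem solidCauchy_eq_integral_shifted (hDo : ∀ j, IsOpen (D j)) (i : Fin n)
    (g : (Fin n → ℂ) → ℂ) (z : Fin n → ℂ) : solidCauchy D i g z =
      -(1 / (2 * Real.pi * Complex.I)) * ∫ w, shiftedIntegrand D i g z w := by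
  unfold solidCauchy
  rw [← integral_indicator (hDo i).measurableSet, ← integral_add_left_eq_self _ (z i)]
  congr 1
  refine integral_congr_ae (Eventually.of_forall fun w => ?_)
  simp only [shiftedIntegrand, indicator, add_sub_cancel_left]
  rfl

theorem exists_shiftedIntegrand_bound (hDb : ∀ j, Bornology.IsBounded (D j))
    {g : (Fin n → ℂ) → ℂ} (hg : BddContOn (univ.pi D) g) (i : Fin n) :
    ∃ φ : ℂ → ℝ, Integrable φ ∧ ∀ z ∈ univ.pi D, ∀ w, ‖shiftedIntegrand D i g z w‖ ≤ φ w := by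
  obtain ⟨M, hM0, hM⟩ := hg.exists_nonneg_bound
  obtain ⟨R, hR⟩ := Metric.isBounded_iff.1 (hDb i)
  refine ⟨indicator (Metric.ball 0 (R + 1)) fun w : ℂ => M * ‖w⁻¹‖ * 2, ?_, fun z hz w => ?_⟩
  · exact (integrable_indicator_iff measurableSet_ball).2
      (((integrableOn_inv_ball (R + 1)).norm.const_mul M).mul_const 2)
  · unfold shiftedIntegrand
    by_cases hw : z i + w ∈ D i
    · have h1 : w ∈ Metric.ball (0 : ℂ) (R + 1) := by
        have := hR hw (hz i trivial)
        rw [dist_eq_norm, add_sub_cancel_left] at this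
        rw [mem_ball_zero_iff]
        linarith
      rw [indicator_of_mem (s := {w | z i + w ∈ D i}) hw, indicator_of_mem h1, div_eq_mul_inv,
        norm_mul, norm_mul]
      have h2 : ‖(2 * Complex.I : ℂ)‖ = 2 := by simp
      rw [h2]
      gcongr
      exact hM _ (update_mem_pi hz hw)
    · rw [indicator_of_notMem (s := {w | z i + w ∈ D i}) hw, norm_zero]
      exact indicator_nonneg (fun _ _ => by positivity) _

theorem aestronglyMeasurable_shiftedIntegrand (hDo : ∀ j, IsOpen (D j)) {g : (Fin n → ℂ) → ℂ}
    (hg : BddContOn (univ.pi D) g) (i : Fin n) {z : Fin n → ℂ} (hz : z ∈ univ.pi D) :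
    AEStronglyMeasurable (shiftedIntegrand D i g z) volume := by
  have h1 : MeasurableSet {w | z i + w ∈ D i} :=
    ((hDo i).preimage (continuous_const.add continuous_id)).measurableSet
  refine (aestronglyMeasurable_indicator_iff h1).2 ?_
  have h2 : ContinuousOn (fun w => g (Function.update z i (z i + w))) {w | z i + w ∈ D i} :=
    hg.1.comp ((continuous_update_right z i).comp (continuous_const.add continuous_id)).continuousOn
      fun _ hw => update_mem_pi hz hw
  simp only [div_eq_mul_inv]
  exact ((h2.aestronglyMeasurable h1).mul measurable_inv.aestronglyMeasurable).mul_const _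

/-- The solid Cauchy transform preserves bounded continuous functions. Continuity in the variable
of integration, too, follows by dominated convergence, once the pole is translated to the origin;
the translates of the indicator of `D i` converge off the boundary of `D i`, which is a null set. -/
theorem BddContOn.solidCauchy (hDo : ∀ j, IsOpen (D j)) (hDb : ∀ j, Bornology.IsBounded (D j))
    (hDf : ∀ j, volume (frontier (D j)) = 0) {g : (Fin n → ℂ) → ℂ}
    (hg : BddContOn (univ.pi D) g) (i : Fin n) : BddContOn (univ.pi D) (solidCauchy D i g) := by
  obtain ⟨φ, hφ, hφ'⟩ := exists_shiftedIntegrand_bound hDb hg i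
  have heq : EqOn (_root_.solidCauchy D i g) (fun z => -(1 / (2 * Real.pi * Complex.I)) *
      ∫ w, shiftedIntegrand D i g z w) (univ.pi D) := fun z _ =>
    solidCauchy_eq_integral_shifted hDo i g z
  refine BddContOn.congr (BddContOn.const_mul _ ⟨?_, ∫ w, φ w, fun z hz =>
    norm_integral_le_of_norm_le hφ (Eventually.of_forall (hφ' z hz))⟩) heq
  intro z hz
  refine tendsto_integral_filter_of_dominated_convergence φ ?_ ?_ hφ ?_
  · exact eventually_mem_nhdsWithin.mono fun y hy =>
      aestronglyMeasurable_shiftedIntegrand hDo hg i hy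
  · exact eventually_mem_nhdsWithin.mono fun y hy => Eventually.of_forall (hφ' y hy)
  · have hnull : ∀ᵐ w, z i + w ∉ frontier (D i) := by
      have := (measurePreserving_add_left (volume : Measure ℂ)
        (z i)).quasiMeasurePreserving.preimage_null (hDf i)
      exact compl_mem_ae_iff.2 this
    filter_upwards [hnull] with w hw
    have hc : Continuous fun y : Fin n → ℂ => y i + w := by fun_prop
    by_cases hw1 : z i + w ∈ D i
    · have h1 : ∀ᶠ y in 𝓝[univ.pi D] z, y i + w ∈ D i :=
        nhdsWithin_le_nhds (hc.continuousAt ((hDo i).mem_nhds hw1))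
      have h2 : Tendsto (fun y => g (Function.update y i (y i + w)) / w * (2 * Complex.I))
          (𝓝[univ.pi D] z) (𝓝 (g (Function.update z i (z i + w)) / w * (2 * Complex.I))) := by
        refine Tendsto.mul_const _ (Tendsto.div_const ?_ _)
        refine (hg.1 _ (update_mem_pi hz hw1)).tendsto.comp (tendsto_nhdsWithin_iff.2 ⟨?_, ?_⟩)
        · exact ((continuous_id.update i hc).continuousAt (x := z)).tendsto.mono_left
            nhdsWithin_le_nhds
        · filter_upwards [h1, eventually_mem_nhdsWithin] with y hy hy'
          exact update_mem_pi hy' hy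
      unfold shiftedIntegrand
      rw [indicator_of_mem (s := {w | z i + w ∈ D i}) hw1]
      exact h2.congr' (h1.mono fun y hy => (indicator_of_mem (s := {w | y i + w ∈ D i}) hy _).symm)
    · have hw2 : z i + w ∈ (closure (D i))ᶜ := fun h => hw ⟨h, by rwa [(hDo i).interior_eq]⟩
      have h1 : ∀ᶠ y in 𝓝[univ.pi D] z, y i + w ∈ (closure (D i))ᶜ :=
        nhdsWithin_le_nhds (hc.continuousAt (isClosed_closure.isOpen_compl.mem_nhds hw2))
      unfold shiftedIntegrand
      rw [indicator_of_notMem (s := {w | z i + w ∈ D i}) hw1]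
      exact tendsto_const_nhds.congr' (h1.mono fun y hy => (indicator_of_notMem
        (s := {w | y i + w ∈ D i}) (fun h => hy (subset_closure h)) _).symm)

/-- On the product domain `g` is bounded and continuous, and so are its Wirtinger derivatives
`a = ∂g/∂z_l` and `b = ∂g/∂z̄_l` in the `l`-th variable. -/
structure HasSliceWirtinger (D : Fin n → Set ℂ) (l : Fin n) (g a b : (Fin n → ℂ) → ℂ) : Prop where
  bddCont : BddContOn (univ.pi D) g
  bddCont_d : BddContOn (univ.pi D) a
  bddCont_dbar : BddContOn (univ.pi D) b
  hasFDerivAt : ∀ z ∈ univ.pi D,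
    HasFDerivAt (fun ζ => g (Function.update z l ζ)) (wirtinger (a z) (b z)) (z l)

theorem HasSliceWirtinger.hasWirtingerOn {l : Fin n} {g a b : (Fin n → ℂ) → ℂ}
    (h : HasSliceWirtinger D l g a b) {z : Fin n → ℂ} (hz : z ∈ univ.pi D) :
    HasWirtingerOn (D l) (fun ζ => g (Function.update z l ζ))
      (fun ζ => a (Function.update z l ζ)) (fun ζ => b (Function.update z l ζ)) where
  bddCont := h.bddCont.slice hz l
  bddCont_d := h.bddCont_d.slice hz l
  bddCont_dbar := h.bddCont_dbar.slice hz l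
  hasFDerivAt ζ hζ := by
    simpa using h.hasFDerivAt _ (update_mem_pi hz hζ)

theorem HasSliceWirtinger.sum {ι : Type*} (t : Finset ι) (c : ι → ℂ) {l : Fin n}
    {g a b : ι → (Fin n → ℂ) → ℂ} (h : ∀ i ∈ t, HasSliceWirtinger D l (g i) (a i) (b i)) :
    HasSliceWirtinger D l (fun z => ∑ i ∈ t, c i * g i z) (fun z => ∑ i ∈ t, c i * a i z)
      (fun z => ∑ i ∈ t, c i * b i z) where
  bddCont := BddContOn.sum t fun i hi => (h i hi).bddCont.const_mul _
  bddCont_d := BddContOn.sum t fun i hi => (h i hi).bddCont_d.const_mul _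
  bddCont_dbar := BddContOn.sum t fun i hi => (h i hi).bddCont_dbar.const_mul _
  hasFDerivAt z hz := by
    refine (HasFDerivAt.fun_sum fun i hi =>
      ((h i hi).hasFDerivAt z hz).const_mul (c i)).congr_fderiv ?_
    ext h
    simp [Finset.sum_add_distrib, Finset.sum_mul, mul_add, mul_assoc]

/-- The solid Cauchy transform in one variable commutes with the Wirtinger derivatives in another
one: differentiation under the integral sign. -/
theorem HasSliceWirtinger.solidCauchy (hDo : ∀ j, IsOpen (D j))
    (hDb : ∀ j, Bornology.IsBounded (D j)) (hDf : ∀ j, volume (frontier (D j)) = 0)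
    {l i : Fin n} (hil : i ≠ l) {g a b : (Fin n → ℂ) → ℂ} (h : HasSliceWirtinger D l g a b) :
    HasSliceWirtinger D l (solidCauchy D i g) (solidCauchy D i a) (solidCauchy D i b) where
  bddCont := h.bddCont.solidCauchy hDo hDb hDf i
  bddCont_d := h.bddCont_d.solidCauchy hDo hDb hDf i
  bddCont_dbar := h.bddCont_dbar.solidCauchy hDo hDb hDf i
  hasFDerivAt z hz := by
    unfold _root_.solidCauchy
    obtain ⟨A, hA0, hA⟩ := h.bddCont_d.exists_nonneg_bound
    obtain ⟨C, hC0, hC⟩ := h.bddCont_dbar.exists_nonneg_bound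
    have hmem : ∀ {η ζ}, η ∈ D l → ζ ∈ D i →
        Function.update (Function.update z l η) i ζ ∈ univ.pi D := fun hη hζ =>
      update_mem_pi (update_mem_pi hz hη) hζ
    have hzl : z l ∈ D l := hz l trivial
    have hzz : Function.update z l (z l) = z := Function.update_eq_self l z
    have hint : ∀ {k : (Fin n → ℂ) → ℂ}, BddContOn (univ.pi D) k → ∀ {η}, η ∈ D l →
        IntegrableOn (fun ζ => k (Function.update (Function.update z l η) i ζ) / (ζ - z i) *
          (2 * Complex.I)) (D i) := fun hk η hη =>
      ((hk.slice (update_mem_pi hz hη) i).integrableOn_div_sub (hDo i) (hDb i) (z i)).mul_const _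
    set F' : ℂ → ℂ → ℂ →L[ℝ] ℂ := fun η ζ => wirtinger
      (a (Function.update (Function.update z l η) i ζ) / (ζ - z i) * (2 * Complex.I))
      (b (Function.update (Function.update z l η) i ζ) / (ζ - z i) * (2 * Complex.I)) with hF'
    have hF'int : ∀ {η}, η ∈ D l → IntegrableOn (F' η) (D i) := fun {η} hη =>
      Integrable.add (Integrable.smul_const (hint h.bddCont_d hη) (ContinuousLinearMap.id ℝ ℂ))
        (Integrable.smul_const (hint h.bddCont_dbar hη) (Complex.conjCLE : ℂ →L[ℝ] ℂ))
    have key := hasFDerivAt_integral_of_dominated_of_fderiv_le (𝕜 := ℝ)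
      (μ := volume.restrict (D i)) (x₀ := z l) (s := D l)
      (F := fun η ζ => g (Function.update (Function.update z l η) i ζ) / (ζ - z i) *
        (2 * Complex.I)) (F' := F')
      (bound := fun ζ => (A + C) * ‖(ζ - z i)⁻¹‖ * 2) ((hDo l).mem_nhds hzl)
      (((hDo l).eventually_mem hzl).mono fun η hη => (hint h.bddCont hη).aestronglyMeasurable)
      (hint h.bddCont hzl) (hF'int hzl).aestronglyMeasurable ?_ ?_ ?_
    · have h1 := (key.const_mul (-(1 / (2 * Real.pi * Complex.I))))
      have h2 : (∫ ζ in D i, F' (z l) ζ) = wirtinger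
          (∫ ζ in D i, a (Function.update z i ζ) / (ζ - z i) * (2 * Complex.I))
          (∫ ζ in D i, b (Function.update z i ζ) / (ζ - z i) * (2 * Complex.I)) := by
        have ha := hint h.bddCont_d hzl
        have hb := hint h.bddCont_dbar hzl
        simp only [hzz] at ha hb
        simp only [hF', hzz, wirtinger]
        rw [integral_add (ha.smul_const _) (hb.smul_const _), integral_smul_const,
          integral_smul_const]
      rw [h2] at h1
      have h3 : ∀ η, (Function.update z l η) i = z i := fun η => by simp [hil]
      simp only [h3]
      refine h1.congr_fderiv ?_
      ext w
      simp
      ring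
    · filter_upwards [ae_restrict_mem (hDo i).measurableSet] with ζ hζ η hη
      refine ContinuousLinearMap.opNorm_le_bound _ (by positivity) fun w => ?_
      have h2 : ‖(2 * Complex.I : ℂ)‖ = 2 := by simp
      rw [hF', wirtinger_apply]
      refine (norm_add_le _ _).trans ?_
      simp only [div_eq_mul_inv, norm_mul (_ * _), norm_mul (a _), norm_mul (b _), h2,
        RCLike.norm_conj]
      have e1 := hA _ (hmem hη hζ)
      have e2 := hC _ (hmem hη hζ)
      have e3 : 0 ≤ ‖(ζ - z i)⁻¹‖ * 2 * ‖w‖ := by positivity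
      nlinarith [mul_le_mul_of_nonneg_right e1 e3, mul_le_mul_of_nonneg_right e2 e3]
    · exact ((integrableOn_inv_sub (hDb i) (z i)).norm.const_mul _).mul_const _
    · filter_upwards [ae_restrict_mem (hDo i).measurableSet] with ζ hζ η hη
      have h1 := h.hasFDerivAt _ (hmem hη hζ)
      have h2 : ∀ ξ, Function.update (Function.update (Function.update z l η) i ζ) l ξ =
          Function.update (Function.update z l ξ) i ζ := fun ξ => by
        rw [Function.update_comm hil, Function.update_idem]
      simp only [h2] at h1
      have h3 : Function.update (Function.update z l η) i ζ l = η := by simp [hil.symm]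
      rw [h3] at h1
      have h4 := h1.mul_const ((ζ - z i)⁻¹ * (2 * Complex.I))
      simp only [div_eq_mul_inv, mul_assoc] at h4 ⊢
      refine h4.congr_fderiv ?_
      ext w
      simp [hF']
      ring

/-- Solid Cauchy transforms in different variables commute, by Fubini's theorem. -/
theorem solidCauchy_comm (hDo : ∀ j, IsOpen (D j)) (hDb : ∀ j, Bornology.IsBounded (D j))
    {i j : Fin n} (hij : i ≠ j) {g : (Fin n → ℂ) → ℂ} (hg : BddContOn (univ.pi D) g)
    {z : Fin n → ℂ} (hz : z ∈ univ.pi D) :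
    solidCauchy D j (solidCauchy D i g) z = solidCauchy D i (solidCauchy D j g) z := by
  unfold solidCauchy
  congr 1
  have h1 : ∀ {i j : Fin n}, i ≠ j → ∀ η, (Function.update z j η) i = z i := fun h η => by
    simp [h]
  simp only [h1 hij, h1 hij.symm]
  have hpull : ∀ {i j : Fin n}, (∫ η in D j, -(1 / (2 * Real.pi * Complex.I)) *
      (∫ ζ in D i, g (Function.update (Function.update z j η) i ζ) / (ζ - z i) *
        (2 * Complex.I)) / (η - z j) * (2 * Complex.I)) =
      -(1 / (2 * Real.pi * Complex.I)) * ∫ η in D j, ∫ ζ in D i,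
        g (Function.update (Function.update z j η) i ζ) * ((η - z j)⁻¹ * (ζ - z i)⁻¹) *
          (2 * Complex.I * (2 * Complex.I)) := by
    intro i j
    rw [← integral_const_mul]
    congr 1 with η
    rw [mul_div_assoc, mul_assoc]
    congr 1
    rw [div_mul_eq_mul_div, mul_div_assoc, ← integral_mul_const]
    congr 1 with ζ
    simp only [div_eq_mul_inv]
    ring
  rw [hpull, hpull]
  congr 1
  rw [integral_integral_swap]
  · congr 1 with ζ
    congr 1 with η
    rw [Function.update_comm hij]
    ring
  · refine Integrable.mul_const ?_ _
    obtain ⟨M, hM⟩ := hg.2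
    rw [Measure.prod_restrict]
    have hmeas : MeasurableSet (D j ×ˢ D i) := ((hDo j).prod (hDo i)).measurableSet
    have hmem : ∀ p ∈ D j ×ˢ D i,
        Function.update (Function.update z j p.1) i p.2 ∈ univ.pi D := fun p hp =>
      update_mem_pi (update_mem_pi hz hp.1) hp.2
    refine Integrable.bdd_mul (c := M) ?_ ?_ ?_
    · rw [← Measure.prod_restrict]
      exact (integrableOn_inv_sub (hDb j) (z j)).mul_prod (integrableOn_inv_sub (hDb i) (z i))
    · refine ContinuousOn.aestronglyMeasurable ?_ hmeas
      refine hg.1.comp (Continuous.continuousOn ?_) hmem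
      exact ((continuous_update_right z j).comp continuous_fst).update i continuous_snd
    · filter_upwards [ae_restrict_mem hmeas] with p hp
      exact hM _ (hmem p hp)

end SolidCauchy

/-! ### The Cauchy–Pompeiu formula for compactly supported functions -/

/-- The Cauchy–Pompeiu formula on the plane, `∫ ∂̄φ(ζ) / (ζ - z) dA = -π φ(z)`. In polar coordinates
centred at `z` the integrand times the Jacobian is `(∂_r φ + (i / r) ∂_θ φ) / 2`; the first term
integrates to `-φ(z)` along rays, and the second one to zero along circles. -/
theorem integral_dbar_div_sub {φ a b : ℂ → ℂ} (h : HasWirtingerOn univ φ a b)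
    (hc : HasCompactSupport φ) (z : ℂ) : ∫ ζ, b ζ / (ζ - z) = -Real.pi * φ z := by
  obtain ⟨R', hR'⟩ := hc.isCompact.isBounded.subset_ball z
  set R := max R' 1 with hR
  have hR0 : 0 < R := by positivity
  have hout : ∀ ζ, R ≤ ‖ζ - z‖ → ζ ∉ tsupport φ := fun ζ hζ hmem => by
    have := hR' hmem
    rw [Metric.mem_ball, dist_eq_norm] at this
    exact absurd (this.trans_le (le_max_left _ _)) (not_lt.2 hζ)
  have hφ0 : ∀ ζ, R ≤ ‖ζ - z‖ → φ ζ = 0 := fun ζ hζ => image_eq_zero_of_notMem_tsupport (hout ζ hζ)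
  have hb0 : ∀ ζ, R ≤ ‖ζ - z‖ → b ζ = 0 := fun ζ hζ =>
    h.dbar_eq_zero (mem_univ ζ) (notMem_tsupport_iff_eventuallyEq.1 (hout ζ hζ))
  set E : ℝ → ℂ := fun θ => Complex.exp (θ * Complex.I) with hE
  have hEd : ∀ θ, HasDerivAt E (E θ * Complex.I) θ := fun θ => by
    have := ((hasDerivAt_id (θ : ℂ)).mul_const Complex.I).cexp.comp_ofReal
    simpa [hE] using this
  have hEc : Continuous E := by fun_prop
  have hEn : ∀ θ, ‖E θ‖ = 1 := fun θ => Complex.norm_exp_ofReal_mul_I θ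
  have hEconj : ∀ θ, starRingEnd ℂ (E θ) = (E θ)⁻¹ := fun θ =>
    (Complex.inv_eq_conj (hEn θ)).symm
  have hE0 : ∀ θ, E θ ≠ 0 := fun θ => Complex.exp_ne_zero _
  have hdist : ∀ (r θ : ℝ), ‖z + r * E θ - z‖ = |r| := fun r θ => by
    rw [add_sub_cancel_left, norm_mul, hEn, mul_one, Complex.norm_real, Real.norm_eq_abs]
  -- the radial derivative of `φ`, and `i / r` times the angular one
  set Vr : ℝ × ℝ → ℂ := fun p => a (z + p.1 * E p.2) * E p.2 + b (z + p.1 * E p.2) * (E p.2)⁻¹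
  set Vt : ℝ × ℝ → ℂ := fun p => -1 * (a (z + p.1 * E p.2) * E p.2) +
    b (z + p.1 * E p.2) * (E p.2)⁻¹
  have hEB : ∀ S : Set (ℝ × ℝ), BddContOn S fun p => E p.2 := fun S =>
    ⟨(hEc.comp continuous_snd).continuousOn, 1, fun p _ => (hEn _).le⟩
  have hEB' : ∀ S : Set (ℝ × ℝ), BddContOn S fun p => (E p.2)⁻¹ := fun S =>
    ⟨((hEc.comp continuous_snd).inv₀ fun p => hE0 _).continuousOn, 1, fun p _ => by
      rw [norm_inv, hEn, inv_one]⟩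
  have hpc : Continuous fun p : ℝ × ℝ => z + p.1 * E p.2 := by fun_prop
  have hA : ∀ S : Set (ℝ × ℝ), BddContOn S fun p => a (z + p.1 * E p.2) := fun S =>
    h.bddCont_d.comp hpc.continuousOn fun _ _ => mem_univ _
  have hB : ∀ S : Set (ℝ × ℝ), BddContOn S fun p => b (z + p.1 * E p.2) := fun S =>
    h.bddCont_dbar.comp hpc.continuousOn fun _ _ => mem_univ _
  have hVr : ∀ S, BddContOn S Vr := fun S => ((hA S).mul (hEB S)).add ((hB S).mul (hEB' S))
  have hVt : ∀ S, BddContOn S Vt := fun S =>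
    (((hA S).mul (hEB S)).const_mul _).add ((hB S).mul (hEB' S))
  set S : Set (ℝ × ℝ) := Ioo 0 R ×ˢ Ioo (-Real.pi) Real.pi with hS
  have hSm : MeasurableSet S := measurableSet_Ioo.prod measurableSet_Ioo
  have hSf : volume S ≠ ⊤ := by
    rw [hS, Measure.volume_eq_prod, Measure.prod_prod]
    simp [ENNReal.mul_eq_top]
  have hVri : IntegrableOn Vr S := (hVr S).integrableOn hSm hSf
  have hVti : IntegrableOn Vt S := (hVt S).integrableOn hSm hSf
  have hpipi : -Real.pi ≤ Real.pi := by linarith [Real.pi_pos]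
  have hrad : ∫ p in S, Vr p = -(2 * Real.pi) * φ z := by
    rw [hS, Measure.volume_eq_prod, ← Measure.prod_restrict]
    rw [hS, IntegrableOn, Measure.volume_eq_prod, ← Measure.prod_restrict] at hVri
    rw [integral_prod_symm _ hVri]
    have : ∀ θ, ∫ r in Ioo 0 R, Vr (r, θ) = -φ z := fun θ => by
      rw [← integral_Ioc_eq_integral_Ioo, ← intervalIntegral.integral_of_le hR0.le,
        intervalIntegral.integral_eq_sub_of_hasDerivAt (f := fun r : ℝ => φ (z + r * E θ))]
      · rw [hφ0 _ (by rw [hdist]; exact le_abs_self R)]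
        simp
      · intro r _
        have h1 : HasDerivAt (fun r : ℝ => z + r * E θ) (E θ) r := by
          simpa using ((hasDerivAt_id (r : ℂ)).mul_const (E θ)).comp_ofReal.const_add z
        have h2 := (h.hasFDerivAt (z + r * E θ) (mem_univ _)).comp_hasDerivAt r h1
        rwa [wirtinger_apply, hEconj] at h2
      · refine ContinuousOn.intervalIntegrable ?_
        exact (hVr univ).1.comp (by fun_prop : Continuous fun r : ℝ => (r, θ)).continuousOn
          fun _ _ => mem_univ _
    simp only [this]
    rw [setIntegral_const, measureReal_def, Real.volume_Ioo, ENNReal.toReal_ofReal (by linarith),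
      Complex.real_smul]
    push_cast
    ring
  have hang : ∫ p in S, Vt p = 0 := by
    rw [hS, Measure.volume_eq_prod, setIntegral_prod _ (by rwa [← Measure.volume_eq_prod])]
    refine setIntegral_eq_zero_of_forall_eq_zero fun r hr => ?_
    have hr0 : (r : ℂ) ≠ 0 := by exact_mod_cast hr.1.ne'
    rw [← integral_Ioc_eq_integral_Ioo, ← intervalIntegral.integral_of_le hpipi,
      intervalIntegral.integral_eq_sub_of_hasDerivAt
        (f := fun θ : ℝ => Complex.I / r * φ (z + r * E θ))]
    · have : E (-Real.pi) = E Real.pi := by simp [hE, Complex.exp_neg, Complex.exp_pi_mul_I]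
      rw [this, sub_self]
    · intro θ _
      have h1 : HasDerivAt (fun θ : ℝ => z + r * E θ) (r * (E θ * Complex.I)) θ :=
        ((hEd θ).const_mul (r : ℂ)).const_add z
      have h2 := ((h.hasFDerivAt (z + r * E θ) (mem_univ _)).comp_hasDerivAt θ h1).const_mul
        (Complex.I / r)
      rw [wirtinger_apply, map_mul, map_mul, hEconj, Complex.conj_I, Complex.conj_ofReal] at h2
      refine h2.congr_deriv ?_
      change _ = -1 * (a (z + r * E θ) * E θ) + b (z + r * E θ) * (E θ)⁻¹
      have hE1 := hE0 θ
      field_simp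
      linear_combination (a (z + r * E θ) * E θ ^ 2 - b (z + r * E θ)) * Complex.I_sq
    · refine ContinuousOn.intervalIntegrable ?_
      exact (hVt univ).1.comp (by fun_prop : Continuous fun θ : ℝ => (r, θ)).continuousOn
        fun _ _ => mem_univ _
  have hpolar : ∫ ζ, b ζ / (ζ - z) =
      ∫ p in polarCoord.target, b (z + p.1 * E p.2) * (E p.2)⁻¹ := by
    rw [← integral_add_left_eq_self _ z, ← Complex.integral_comp_polarCoord_symm]
    refine setIntegral_congr_fun polarCoord.open_target.measurableSet fun p hp => ?_
    rw [polarCoord_target] at hp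
    have hp0 : (p.1 : ℂ) ≠ 0 := by exact_mod_cast (show (0 : ℝ) < p.1 from hp.1).ne'
    have he : Complex.polarCoord.symm p = p.1 * E p.2 := by
      simp [hE, Complex.exp_mul_I]
    have := hE0 p.2
    simp only [he, add_sub_cancel_left, Complex.real_smul]
    field_simp
  have hcut : ∫ p in polarCoord.target, b (z + p.1 * E p.2) * (E p.2)⁻¹ =
      ∫ p in S, b (z + p.1 * E p.2) * (E p.2)⁻¹ := by
    refine setIntegral_eq_of_subset_of_forall_sdiff_eq_zero
      polarCoord.open_target.measurableSet ?_ ?_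
    · rw [polarCoord_target]
      exact prod_mono Ioo_subset_Ioi_self le_rfl
    · rintro p ⟨hp, hpS⟩
      rw [polarCoord_target] at hp
      have : R ≤ p.1 := not_lt.1 fun hlt => hpS ⟨⟨hp.1, hlt⟩, hp.2⟩
      rw [hb0 _ (by rw [hdist]; exact this.trans (le_abs_self _)), zero_mul]
  have hsplit : ∀ p, b (z + p.1 * E p.2) * (E p.2)⁻¹ = (Vr p + Vt p) * (1 / 2) := fun p => by
    simp only [Vr, Vt]
    ring
  rw [hpolar, hcut]
  simp only [hsplit]
  rw [integral_mul_const, integral_add hVri hVti, hrad, hang]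
  ring

/-! ### Collars of the boundary curves -/

/-- The real-linear map `h ↦ (Re h) a + (Im h) b` of the plane. -/
def collarDeriv (a b : ℂ) : ℂ →L[ℝ] ℂ :=
  Complex.reCLM.smulRight a + Complex.imCLM.smulRight b

@[simp]
theorem collarDeriv_apply (a b h : ℂ) : collarDeriv a b h = h.re * a + h.im * b := by
  simp [collarDeriv]

theorem det_collarDeriv (a b : ℂ) : (collarDeriv a b).det = a.re * b.im - a.im * b.re := by
  rw [ContinuousLinearMap.det, ← LinearMap.det_toMatrix Complex.basisOneI, Matrix.det_fin_two]
  simp [LinearMap.toMatrix_apply, Complex.coe_basisOneI_repr]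
  ring

/-- Coordinates near the point `γ t₀` of a curve: `t + i s` is sent to `γ t` displaced by `s` times
the left normal of the curve at `t₀`. The direction of displacement does not depend on `t`, so the
map is as smooth as `γ` is. -/
def collarMap (γ : ℝ → ℂ) (t₀ : ℝ) (w : ℂ) : ℂ :=
  γ w.re + w.im * (Complex.I * deriv γ t₀)

/-- The square of side `2δ` centred at the point `t₀` of the real axis. -/
def collarBox (t₀ δ : ℝ) : Set ℂ := Ioo (t₀ - δ) (t₀ + δ) ×ℂ Ioo (-δ) δ

theorem isOpen_collarBox (t₀ δ : ℝ) : IsOpen (collarBox t₀ δ) := isOpen_Ioo.reProdIm isOpen_Ioo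

theorem ofReal_mem_collarBox {t₀ δ t : ℝ} (ht : t ∈ Ioo (t₀ - δ) (t₀ + δ)) :
    (t : ℂ) ∈ collarBox t₀ δ := by
  have : 0 < δ := by linarith [ht.1, ht.2]
  exact ⟨by simpa using ht, by simpa using this⟩

@[simp]
theorem collarMap_ofReal (γ : ℝ → ℂ) (t₀ t : ℝ) : collarMap γ t₀ t = γ t := by simp [collarMap]

theorem contDiff_collarMap {γ : ℝ → ℂ} (hγ : ContDiff ℝ 1 γ) (t₀ : ℝ) :
    ContDiff ℝ 1 (collarMap γ t₀) := by
  have h1 : ContDiff ℝ 1 fun w : ℂ => γ w.re := hγ.comp Complex.reCLM.contDiff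
  have h2 : ContDiff ℝ 1 fun w : ℂ => (w.im : ℂ) :=
    Complex.ofRealCLM.contDiff.comp Complex.imCLM.contDiff
  exact h1.add (h2.mul contDiff_const)

theorem hasFDerivAt_collarMap {γ : ℝ → ℂ} (hγ : ContDiff ℝ 1 γ) (t₀ : ℝ) (w : ℂ) :
    HasFDerivAt (collarMap γ t₀) (collarDeriv (deriv γ w.re) (Complex.I * deriv γ t₀)) w := by
  have h1 : HasFDerivAt (fun w : ℂ => γ w.re) (Complex.reCLM.smulRight (deriv γ w.re)) w := by
    have h := (hγ.differentiable one_ne_zero w.re).hasDerivAt.hasFDerivAt.comp w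
      Complex.reCLM.hasFDerivAt
    refine h.congr_fderiv ?_
    ext x
    simp
  have h2 : HasFDerivAt (fun w : ℂ => (w.im : ℂ) * (Complex.I * deriv γ t₀))
      (Complex.imCLM.smulRight (Complex.I * deriv γ t₀)) w := by
    refine ((Complex.ofRealCLM.hasFDerivAt.comp w
      Complex.imCLM.hasFDerivAt).mul_const (Complex.I * deriv γ t₀)).congr_fderiv ?_
    ext x
    simp
    ring
  exact h1.add h2

namespace PositiveBoundary

variable {m : ℕ} {α : ℝ} {D : Set ℂ}

theorem contDiff_curve (B : PositiveBoundary m α D) (hm : 1 ≤ m) (c : Fin B.N) :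
    ContDiff ℝ 1 (B.curve c) :=
  (contDiffOn_univ.1 (B.regularity c).1).of_le (by exact_mod_cast hm)

theorem curve_mem_frontier (B : PositiveBoundary m α D) (c : Fin B.N) (t : ℝ) :
    B.curve c t ∈ frontier D := by
  rw [← B.iUnion_range]
  exact mem_iUnion.2 ⟨c, t, rfl⟩

/-- A boundary curve passes through a given point once per period. -/
theorem eq_of_curve_eq (B : PositiveBoundary m α D) (c : Fin B.N) {t t₀ : ℝ}
    (ht : t ∈ Icc (t₀ - 1 / 2) (t₀ + 1 / 2)) (h : B.curve c t = B.curve c t₀) : t = t₀ := by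
  have hfr : ∀ s, B.curve c (Int.fract s) = B.curve c s := fun s => by
    have := (B.periodic c).sub_int_mul_eq ⌊s⌋ (x := s)
    rwa [mul_one] at this
  have h1 : Int.fract t = Int.fract t₀ := B.injOn c ⟨Int.fract_nonneg _, Int.fract_lt_one _⟩
    ⟨Int.fract_nonneg _, Int.fract_lt_one _⟩ (by rw [hfr, hfr, h])
  obtain ⟨z, hz⟩ := Int.fract_eq_fract.1 h1
  have h2 : z = 0 := by
    have h3 : (z : ℝ) < 1 := by linarith [ht.2]
    have h4 : (-1 : ℝ) < z := by linarith [ht.1]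
    have h3' : z < 1 := by exact_mod_cast h3
    have h4' : -1 < z := by exact_mod_cast h4
    omega
  rw [h2] at hz
  simp at hz
  linarith

/-- A collar of the boundary at the point `γ t₀` of the `c`-th boundary curve `γ`: a chart, given by
`collarMap`, in which the boundary is the real axis and `D` is the upper half of a square. -/
structure Collar (B : PositiveBoundary m α D) (c : Fin B.N) (t₀ : ℝ) where
  /-- half the side of the square -/
  δ : ℝ
  pos : 0 < δ
  lt_half : δ < 1 / 2
  /-- the chart, from the square to the plane -/
  chart : OpenPartialHomeomorph ℂ ℂ
  source_eq : chart.source = collarBox t₀ δ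
  coe_eq : ⇑chart = collarMap (B.curve c) t₀
  jacobian_pos : ∀ t ∈ Ioo (t₀ - δ) (t₀ + δ),
    0 < (deriv (B.curve c) t).re * (deriv (B.curve c) t₀).re +
      (deriv (B.curve c) t).im * (deriv (B.curve c) t₀).im
  mem_iff : ∀ w ∈ collarBox t₀ δ, collarMap (B.curve c) t₀ w ∈ D ↔ 0 < w.im
  notMem_of_ne : ∀ c', c' ≠ c → ∀ t, B.curve c' t ∉ chart.target
  mem_Ioo : ∀ t ∈ Icc (t₀ - 1 / 2) (t₀ + 1 / 2), B.curve c t ∈ chart.target →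
    t ∈ Ioo (t₀ - δ) (t₀ + δ)

theorem exists_collarBox_subset {t₀ : ℝ} {V : Set ℂ} (hV : V ∈ 𝓝 (t₀ : ℂ)) :
    ∃ δ : ℝ, 0 < δ ∧ ∀ δ' ≤ δ, collarBox t₀ δ' ⊆ V := by
  obtain ⟨ε, hε, h⟩ := Metric.mem_nhds_iff.1 hV
  refine ⟨ε / 2, by positivity, fun δ' hδ' w hw => h ?_⟩
  obtain ⟨⟨h1, h2⟩, h3, h4⟩ := hw
  rw [Metric.mem_ball, dist_eq_norm]
  refine (Complex.norm_le_abs_re_add_abs_im _).trans_lt ?_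
  have h5 : |(w - t₀).re| < ε / 2 := by
    rw [abs_lt]; constructor <;> simp <;> linarith
  have h6 : |(w - t₀).im| < ε / 2 := by
    rw [abs_lt]; constructor <;> simp <;> linarith
  linarith

/-- Every boundary point has a collar. The inverse function theorem gives the chart; by compactness
the rest of the boundary stays away from `γ t₀`, so that the boundary meets a small square only in
the real axis; each half of the square is connected, hence lies in `D` or outside its closure, and
the one-sidedness of the boundary decides which. -/
theorem nonempty_collar (B : PositiveBoundary m α D) (hm : 1 ≤ m) (hD : IsOpen D) (c : Fin B.N)
    (t₀ : ℝ) : Nonempty (B.Collar c t₀) := by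
  set γ := B.curve c with hγdef
  have hγ : ContDiff ℝ 1 γ := B.contDiff_curve hm c
  set τ := deriv γ t₀ with hτ
  have hτ0 : τ ≠ 0 := B.deriv_ne_zero c t₀
  have hτpos : 0 < τ.re * τ.re + τ.im * τ.im := by
    have := Complex.normSq_pos.2 hτ0
    rwa [Complex.normSq_apply] at this
  set Φ := collarMap γ t₀ with hΦ
  have hΦc : ContDiff ℝ 1 Φ := contDiff_collarMap hγ t₀
  have hdet : (collarDeriv (deriv γ t₀) (Complex.I * deriv γ t₀)).det ≠ 0 := by
    rw [det_collarDeriv, ← hτ]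
    simp
    linarith
  have hstrict : HasStrictFDerivAt Φ (((collarDeriv (deriv γ t₀)
      (Complex.I * deriv γ t₀)).toContinuousLinearEquivOfDetNeZero hdet : ℂ ≃L[ℝ] ℂ) :
        ℂ →L[ℝ] ℂ) (t₀ : ℂ) := by
    rw [ContinuousLinearMap.coe_toContinuousLinearEquivOfDetNeZero]
    have h := hasFDerivAt_collarMap hγ t₀ (t₀ : ℂ)
    rw [Complex.ofReal_re] at h
    exact hΦc.contDiffAt.hasStrictFDerivAt' h one_ne_zero
  set e := hstrict.toOpenPartialHomeomorph Φ with he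
  have hecoe : ⇑e = Φ := hstrict.toOpenPartialHomeomorph_coe
  have het₀ : (t₀ : ℂ) ∈ e.source := hstrict.mem_toOpenPartialHomeomorph_source
  have hJ : ∀ᶠ t in 𝓝 t₀, 0 < (deriv γ t).re * τ.re + (deriv γ t).im * τ.im := by
    have hdc : Continuous (deriv γ) := hγ.continuous_deriv le_rfl
    have h1 : Continuous fun t => (deriv γ t).re * τ.re + (deriv γ t).im * τ.im :=
      ((Complex.continuous_re.comp hdc).mul continuous_const).add
        ((Complex.continuous_im.comp hdc).mul continuous_const)
    exact h1.continuousAt.eventually (lt_mem_nhds hτpos)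
  obtain ⟨δJ, hδJ, hJ'⟩ := Metric.eventually_nhds_iff.1 hJ
  obtain ⟨δe, hδe, hbe⟩ := exists_collarBox_subset (e.open_source.mem_nhds het₀)
  set δ₁ := min (min δJ δe) (1 / 4) with hδ₁
  have hδ₁0 : 0 < δ₁ := by positivity
  have hδ₁J : δ₁ ≤ δJ := (min_le_left _ _).trans (min_le_left _ _)
  have hδ₁e : δ₁ ≤ δe := (min_le_left _ _).trans (min_le_right _ _)
  have hδ₁4 : δ₁ ≤ 1 / 4 := min_le_right _ _
  -- the part of the boundary that has to be avoided
  set K : Set ℂ := (⋃ c' ∈ {c' | c' ≠ c}, B.curve c' '' Icc 0 1) ∪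
    γ '' (Icc (t₀ - 1 / 2) (t₀ + 1 / 2) \ Ioo (t₀ - δ₁) (t₀ + δ₁)) with hK
  have hKc : IsClosed K := by
    refine (IsCompact.union ?_ ?_).isClosed
    · exact (Set.toFinite _).isCompact_biUnion fun c' _ =>
        isCompact_Icc.image (B.contDiff_curve hm c').continuous
    · exact (isCompact_Icc.diff isOpen_Ioo).image hγ.continuous
  have hrange : ∀ c', B.curve c' '' Icc 0 1 = range (B.curve c') := fun c' => by
    have := (B.periodic c').image_Icc one_pos 0
    rwa [zero_add] at this
  have hpK : γ t₀ ∉ K := by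
    rintro (h | ⟨t, ⟨ht, ht'⟩, h⟩)
    · simp only [mem_iUnion, hrange] at h
      obtain ⟨c', hc', h⟩ := h
      exact disjoint_left.1 (B.disjoint hc') h ⟨t₀, rfl⟩
    · have := B.eq_of_curve_eq c ht h
      exact ht' (by rw [this]; constructor <;> linarith)
  have hΦt₀ : Φ (t₀ : ℂ) = γ t₀ := collarMap_ofReal γ t₀ t₀
  obtain ⟨δK, hδK, hbK⟩ := exists_collarBox_subset (t₀ := t₀) (V := Φ ⁻¹' Kᶜ)
    (hΦc.continuous.continuousAt (hKc.isOpen_compl.mem_nhds (by rwa [hΦt₀])))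
  set δ := min δ₁ δK with hδ
  have hδ0 : 0 < δ := by positivity
  have hδδ₁ : δ ≤ δ₁ := min_le_left _ _
  have hsub₁ : collarBox t₀ δ₁ ⊆ e.source := hbe _ hδ₁e
  have hsub : collarBox t₀ δ ⊆ e.source := hbe _ (hδδ₁.trans hδ₁e)
  have hsubK : ∀ w ∈ collarBox t₀ δ, Φ w ∉ K := fun w hw => hbK _ (min_le_right _ _) hw
  have hinj : InjOn Φ e.source := by rw [← hecoe]; exact e.injOn
  -- a point of the curve in the image of the small square comes from the real axis
  have hcurve : ∀ t ∈ Icc (t₀ - 1 / 2) (t₀ + 1 / 2), ∀ w ∈ collarBox t₀ δ, Φ w = γ t →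
      w = t := fun t ht w hw hwt => by
    have h1 : t ∈ Ioo (t₀ - δ₁) (t₀ + δ₁) := by
      by_contra h
      exact hsubK w hw (Or.inr ⟨t, ⟨ht, h⟩, hwt.symm⟩)
    refine hinj (hsub hw) (hsub₁ (ofReal_mem_collarBox h1)) ?_
    rw [hwt, hΦ, collarMap_ofReal]
  have hne : ∀ c', c' ≠ c → ∀ t, ∀ w ∈ collarBox t₀ δ, Φ w ≠ B.curve c' t :=
      fun c' hc' t w hw h => by
    refine hsubK w hw (Or.inl ?_)
    simp only [mem_iUnion, hrange]
    exact ⟨c', hc', t, h.symm⟩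
  have hfr : ∀ w ∈ collarBox t₀ δ, Φ w ∈ frontier D → w.im = 0 := fun w hw h => by
    rw [← B.iUnion_range, mem_iUnion] at h
    obtain ⟨c', t', ht'⟩ := h
    rcases eq_or_ne c' c with rfl | hc'
    · obtain ⟨t, ht, htt'⟩ := (B.periodic c').exists_mem_Ico one_pos t' (t₀ - 1 / 2)
      have := hcurve t ⟨ht.1, by linarith [ht.2]⟩ w hw (by rw [← ht', htt'])
      rw [this, Complex.ofReal_im]
    · exact absurd ht'.symm (hne c' hc' t' w hw)
  have hcover : ∀ w ∈ collarBox t₀ δ, w.im ≠ 0 → Φ w ∈ D ∪ (closure D)ᶜ := fun w hw h0 => by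
    by_cases h : Φ w ∈ closure D
    · left
      by_contra h'
      exact h0 (hfr w hw ⟨h, by rwa [hD.interior_eq]⟩)
    · exact Or.inr h
  have hdisj : Disjoint D (closure D)ᶜ := disjoint_left.2 fun x hx hx' => hx' (subset_closure hx)
  have hconn : ∀ s : Set ℝ, Convex ℝ s →
      IsPreconnected (Φ '' (Ioo (t₀ - δ) (t₀ + δ) ×ℂ s)) := fun s hs => by
    refine IsPreconnected.image ?_ _ hΦc.continuous.continuousOn
    refine Convex.isPreconnected ?_
    exact ((convex_Ioo (t₀ - δ) (t₀ + δ)).is_linear_preimage Complex.reLm.isLinear).inter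
      (hs.is_linear_preimage Complex.imLm.isLinear)
  have ht₀ : t₀ ∈ Ioo (t₀ - δ) (t₀ + δ) := ⟨by linarith, by linarith⟩
  have hup : Φ '' (Ioo (t₀ - δ) (t₀ + δ) ×ℂ Ioo 0 δ) ⊆ D := by
    refine IsPreconnected.subset_left_of_subset_union hD isClosed_closure.isOpen_compl hdisj ?_ ?_
      (hconn _ (convex_Ioo _ _))
    · rintro _ ⟨w, ⟨h1, h2⟩, rfl⟩
      exact hcover w ⟨h1, by linarith [show 0 < w.im from h2.1], h2.2⟩ (ne_of_gt h2.1)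
    · obtain ⟨ε, h1, h2⟩ := ((B.left_mem c t₀).and (Ioo_mem_nhdsGT hδ0)).exists
      refine ⟨_, ⟨(t₀ : ℂ) + ε * Complex.I, ⟨by simpa using ht₀, by simpa using h2⟩, rfl⟩, ?_⟩
      simpa [Φ, collarMap] using h1
  have hdown : Φ '' (Ioo (t₀ - δ) (t₀ + δ) ×ℂ Ioo (-δ) 0) ⊆ (closure D)ᶜ := by
    refine IsPreconnected.subset_left_of_subset_union isClosed_closure.isOpen_compl hD hdisj.symm
      ?_ ?_ (hconn _ (convex_Ioo _ _))
    · rintro _ ⟨w, ⟨h1, h2⟩, rfl⟩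
      exact (hcover w ⟨h1, h2.1, by linarith [show w.im < 0 from h2.2]⟩ (ne_of_lt h2.2)).symm
    · obtain ⟨ε, h1, h2⟩ := ((B.right_notMem c t₀).and (Ioo_mem_nhdsGT hδ0)).exists
      refine ⟨_, ⟨(t₀ : ℂ) + ((-ε : ℝ) : ℂ) * Complex.I, ⟨by simpa using ht₀, ?_⟩, rfl⟩, ?_⟩
      · simpa using h2.symm
      · simpa [Φ, collarMap, sub_eq_add_neg] using h1
  have hsource : (e.restrOpen _ (isOpen_collarBox t₀ δ)).source = collarBox t₀ δ := by
    rw [OpenPartialHomeomorph.restrOpen_source, inter_eq_right.2 hsub]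
  have hcoe : ⇑(e.restrOpen _ (isOpen_collarBox t₀ δ)) = Φ := hecoe
  have htarget : ∀ p ∈ (e.restrOpen _ (isOpen_collarBox t₀ δ)).target,
      ∃ w ∈ collarBox t₀ δ, Φ w = p := fun p hp => by
    rw [← OpenPartialHomeomorph.image_source_eq_target, hsource, hcoe] at hp
    exact hp
  refine ⟨⟨δ, hδ0, by linarith, e.restrOpen _ (isOpen_collarBox t₀ δ), hsource, hcoe,
    fun t ht => hJ' ?_, fun w hw => ⟨fun h => ?_, fun h => hup ⟨w, ⟨hw.1, h, hw.2.2⟩, rfl⟩⟩,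
    fun c' hc' t ht => ?_, fun t ht h => ?_⟩⟩
  · rw [Real.dist_eq, abs_lt]
    constructor <;> linarith [ht.1, ht.2]
  · by_contra h0
    rcases (not_lt.1 h0).lt_or_eq with h1 | h1
    · exact hdown ⟨w, ⟨hw.1, hw.2.1, h1⟩, rfl⟩ (subset_closure h)
    · have hw' : w = (w.re : ℂ) := Complex.ext rfl (by simpa using h1)
      have h2 : collarMap γ t₀ w ∈ frontier D := by
        rw [hw', collarMap_ofReal]
        exact B.curve_mem_frontier c _
      rw [hD.frontier_eq] at h2
      exact h2.2 h
  · obtain ⟨w, hw, h⟩ := htarget _ ht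
    exact hne c' hc' t w hw h
  · obtain ⟨w, hw, hwt⟩ := htarget _ h
    have h1 := hcurve t ht w hw hwt
    have h2 := hw.1
    rw [h1] at h2
    simpa using h2

end PositiveBoundary

/-! ### Boundary values and Green's formula in a collar -/

theorem norm_wirtinger_le (a b : ℂ) : ‖wirtinger a b‖ ≤ ‖a‖ + ‖b‖ :=
  ContinuousLinearMap.opNorm_le_bound _ (by positivity) fun h => by
    rw [wirtinger_apply, add_mul]
    refine (norm_add_le _ _).trans ?_
    simp

theorem norm_collarDeriv_le (a b : ℂ) : ‖collarDeriv a b‖ ≤ ‖a‖ + ‖b‖ :=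
  ContinuousLinearMap.opNorm_le_bound _ (by positivity) fun h => by
    rw [collarDeriv_apply, add_mul]
    refine (norm_add_le _ _).trans ?_
    rw [norm_mul, norm_mul, Complex.norm_real, Complex.norm_real, mul_comm ‖a‖, mul_comm ‖b‖]
    gcongr
    · exact Complex.abs_re_le_norm h
    · exact Complex.abs_im_le_norm h

/-- A `C¹` curve in the plane is a null set. -/
theorem volume_range_eq_zero {γ : ℝ → ℂ} (hγ : ContDiff ℝ 1 γ) : volume (range γ) = 0 := by
  have h1 : volume (LinearMap.ker Complex.imLm : Set ℂ) = 0 := by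
    refine Measure.addHaar_submodule _ _ fun h => ?_
    have : Complex.I ∈ LinearMap.ker Complex.imLm := by rw [h]; trivial
    simp at this
  have h2 : DifferentiableOn ℝ (fun w : ℂ => γ w.re) (LinearMap.ker Complex.imLm : Set ℂ) :=
    ((hγ.comp Complex.reCLM.contDiff).differentiable one_ne_zero).differentiableOn
  refine measure_mono_null ?_ (addHaar_image_eq_zero_of_differentiableOn_of_addHaar_eq_zero
    volume h2 h1)
  rintro _ ⟨t, rfl⟩
  exact ⟨t, by simp, by simp⟩

theorem setIntegral_reProdIm (s t : Set ℝ) (F : ℂ → ℂ) :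
    ∫ w in s ×ℂ t, F w = ∫ p in s ×ˢ t, F (p.1 + p.2 * Complex.I) := by
  rw [← Complex.volume_preserving_equiv_real_prod.symm.setIntegral_preimage_emb
    Complex.measurableEquivRealProd.symm.measurableEmbedding]
  have h : ∀ p : ℝ × ℝ, Complex.measurableEquivRealProd.symm p = p.1 + p.2 * Complex.I :=
    fun p => Complex.mk_eq_add_mul_I _ _
  simp only [h]
  congr 2

namespace PositiveBoundary

variable {m : ℕ} {α : ℝ} {D : Set ℂ} {B : PositiveBoundary m α D}

theorem volume_frontier (B : PositiveBoundary m α D) (hm : 1 ≤ m) : volume (frontier D) = 0 := by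
  rw [← B.iUnion_range]
  exact measure_iUnion_null fun c => volume_range_eq_zero (B.contDiff_curve hm c)

namespace Collar

variable {c : Fin B.N} {t₀ : ℝ}

/-- The upper half of the coordinate square of a collar. -/
def upper (C : B.Collar c t₀) : Set ℂ := Ioo (t₀ - C.δ) (t₀ + C.δ) ×ℂ Ioo 0 C.δ

theorem upper_subset (C : B.Collar c t₀) : C.upper ⊆ collarBox t₀ C.δ := fun _ hw =>
  ⟨hw.1, by linarith [C.pos, hw.2.1], hw.2.2⟩

theorem isOpen_upper (C : B.Collar c t₀) : IsOpen C.upper := isOpen_Ioo.reProdIm isOpen_Ioo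

theorem map_mem (C : B.Collar c t₀) {w : ℂ} (hw : w ∈ C.upper) :
    collarMap (B.curve c) t₀ w ∈ D :=
  (C.mem_iff w (C.upper_subset hw)).2 hw.2.1

theorem symm_mem_upper (C : B.Collar c t₀) {ζ : ℂ} (hζ : ζ ∈ C.chart.target) (hζD : ζ ∈ D) :
    C.chart.symm ζ ∈ C.upper := by
  have h1 : C.chart.symm ζ ∈ collarBox t₀ C.δ := by
    rw [← C.source_eq]; exact C.chart.map_target hζ
  have h2 : collarMap (B.curve c) t₀ (C.chart.symm ζ) = ζ := by
    rw [← C.coe_eq]; exact C.chart.right_inv hζ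
  exact ⟨h1.1, (C.mem_iff _ h1).1 (by rwa [h2]), h1.2.2⟩

theorem image_upper (C : B.Collar c t₀) :
    collarMap (B.curve c) t₀ '' C.upper = D ∩ C.chart.target := by
  ext ζ
  constructor
  · rintro ⟨w, hw, rfl⟩
    refine ⟨C.map_mem hw, ?_⟩
    rw [← C.coe_eq]
    exact C.chart.map_source (by rw [C.source_eq]; exact C.upper_subset hw)
  · rintro ⟨h1, h2⟩
    exact ⟨_, C.symm_mem_upper h2 h1, by rw [← C.coe_eq]; exact C.chart.right_inv h2⟩

theorem curve_mem_target (C : B.Collar c t₀) {t : ℝ} (ht : t ∈ Ioo (t₀ - C.δ) (t₀ + C.δ)) :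
    B.curve c t ∈ C.chart.target := by
  have h := C.chart.map_source (x := (t : ℂ)) (by rw [C.source_eq]; exact ofReal_mem_collarBox ht)
  rwa [C.coe_eq, collarMap_ofReal] at h

theorem hasFDerivAt_comp (C : B.Collar c t₀) (hm : 1 ≤ m) {u a b : ℂ → ℂ}
    (h : HasWirtingerOn D u a b) {w : ℂ} (hw : w ∈ C.upper) :
    HasFDerivAt (fun w => u (collarMap (B.curve c) t₀ w))
      ((wirtinger (a (collarMap (B.curve c) t₀ w)) (b (collarMap (B.curve c) t₀ w))).comp
        (collarDeriv (deriv (B.curve c) w.re) (Complex.I * deriv (B.curve c) t₀))) w :=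
  (h.hasFDerivAt _ (C.map_mem hw)).comp w
    (hasFDerivAt_collarMap (B.contDiff_curve hm c) t₀ w)

/-- A function with bounded derivatives is Lipschitz in the coordinates of a collar, where the
domain is convex, and so has a limit at the boundary. -/
theorem exists_tendsto (C : B.Collar c t₀) (hm : 1 ≤ m) {u a b : ℂ → ℂ}
    (h : HasWirtingerOn D u a b) : ∃ y, Tendsto u (𝓝[D] (B.curve c t₀)) (𝓝 y) := by
  obtain ⟨M₁, hM₁0, hM₁⟩ := h.bddCont_d.exists_nonneg_bound
  obtain ⟨M₂, hM₂0, hM₂⟩ := h.bddCont_dbar.exists_nonneg_bound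
  obtain ⟨M₃, hM₃⟩ := (isCompact_Icc (a := t₀ - C.δ) (b := t₀ + C.δ)).exists_bound_of_continuousOn
    ((B.contDiff_curve hm c).continuous_deriv le_rfl).continuousOn
  set M : ℝ := (M₁ + M₂) * (M₃ + ‖Complex.I * deriv (B.curve c) t₀‖)
  have hconv : Convex ℝ C.upper :=
    ((convex_Ioo _ _).is_linear_preimage Complex.reLm.isLinear).inter
      ((convex_Ioo _ _).is_linear_preimage Complex.imLm.isLinear)
  have hlip : LipschitzOnWith M.toNNReal (fun w => u (collarMap (B.curve c) t₀ w)) C.upper := by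
    refine hconv.lipschitzOnWith_of_nnnorm_hasFDerivWithin_le
      (fun w hw => (C.hasFDerivAt_comp hm h hw).hasFDerivWithinAt) fun w hw => ?_
    rw [← NNReal.coe_le_coe, coe_nnnorm]
    refine le_trans ?_ (Real.le_coe_toNNReal M)
    refine (ContinuousLinearMap.opNorm_comp_le _ _).trans ?_
    refine mul_le_mul ((norm_wirtinger_le _ _).trans
      (add_le_add (hM₁ _ (C.map_mem hw)) (hM₂ _ (C.map_mem hw))))
      ((norm_collarDeriv_le _ _).trans (add_le_add (hM₃ _ (Ioo_subset_Icc_self hw.1)) le_rfl))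
      (norm_nonneg _) (by positivity)
  obtain ⟨g, hg, hgu⟩ := hlip.extend_finite_dimension
  have hmem : B.curve c t₀ ∈ C.chart.target :=
    C.curve_mem_target ⟨by linarith [C.pos], by linarith [C.pos]⟩
  refine ⟨g (C.chart.symm (B.curve c t₀)), ?_⟩
  have h1 : Tendsto (fun ζ => g (C.chart.symm ζ)) (𝓝[D] (B.curve c t₀))
      (𝓝 (g (C.chart.symm (B.curve c t₀)))) :=
    (hg.continuous.continuousAt.comp (C.chart.continuousAt_symm hmem)).tendsto.mono_left
      nhdsWithin_le_nhds
  refine h1.congr' ?_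
  filter_upwards [nhdsWithin_le_nhds (C.chart.open_target.mem_nhds hmem),
    eventually_mem_nhdsWithin] with ζ h2 h3
  refine (hgu (C.symm_mem_upper h2 h3)).symm.trans ?_
  simp only
  rw [← C.coe_eq, C.chart.right_inv h2]

end Collar

/-- A function of class `C¹` with bounded derivatives has boundary values. -/
theorem exists_tendsto (B : PositiveBoundary m α D) (hm : 1 ≤ m) (hD : IsOpen D) {u a b : ℂ → ℂ}
    (h : HasWirtingerOn D u a b) {ζ : ℂ} (hζ : ζ ∈ frontier D) : ∃ y, Tendsto u (𝓝[D] ζ) (𝓝 y) := by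
  rw [← B.iUnion_range, mem_iUnion] at hζ
  obtain ⟨c, t₀, rfl⟩ := hζ
  exact (B.nonempty_collar hm hD c t₀).some.exists_tendsto hm h

theorem tendsto_extendFrom (B : PositiveBoundary m α D) (hm : 1 ≤ m) (hD : IsOpen D)
    {u a b : ℂ → ℂ} (h : HasWirtingerOn D u a b) {ζ : ℂ} (hζ : ζ ∈ frontier D) :
    Tendsto u (𝓝[D] ζ) (𝓝 (extendFrom D u ζ)) :=
  _root_.tendsto_extendFrom (B.exists_tendsto hm hD h hζ)

theorem continuousOn_extendFrom (B : PositiveBoundary m α D) (hm : 1 ≤ m) (hD : IsOpen D)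
    {u a b : ℂ → ℂ} (h : HasWirtingerOn D u a b) :
    ContinuousOn (extendFrom D u) (closure D) := by
  refine _root_.continuousOn_extendFrom le_rfl fun ζ hζ => ?_
  by_cases hζD : ζ ∈ D
  · exact ⟨u ζ, h.bddCont.1 ζ hζD⟩
  · exact B.exists_tendsto hm hD h ⟨hζ, by rwa [hD.interior_eq]⟩

/-- The boundary values vanish off every closed set outside of which the function vanishes. -/
theorem extendFrom_eq_zero {u : ℂ → ℂ} {K : Set ℂ} (hK : IsClosed K)
    (h0 : ∀ ζ ∈ D, ζ ∉ K → u ζ = 0) {ζ : ℂ} (hζ : ζ ∈ frontier D) (hζK : ζ ∉ K) :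
    extendFrom D u ζ = 0 := by
  refine extendFrom_eq hζ.1 (tendsto_const_nhds.congr' ?_)
  filter_upwards [nhdsWithin_le_nhds (hK.isOpen_compl.mem_nhds hζK),
    eventually_mem_nhdsWithin] with w h1 h2
  exact (h0 w h2 h1).symm

/-- Outside of a closed set off which `u` vanishes, `∂̄u` vanishes, too. -/
theorem dbar_eq_zero_of_notMem (hD : IsOpen D) {u a b : ℂ → ℂ} (h : HasWirtingerOn D u a b)
    {K : Set ℂ} (hK : IsClosed K) (h0 : ∀ ζ ∈ D, ζ ∉ K → u ζ = 0) {ζ : ℂ} (hζ : ζ ∈ D)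
    (hζK : ζ ∉ K) : b ζ = 0 := by
  refine h.dbar_eq_zero hζ ?_
  filter_upwards [hK.isOpen_compl.mem_nhds hζK, hD.mem_nhds hζ] with w h1 h2
  exact h0 w h2 h1

namespace Collar

variable {c : Fin B.N} {t₀ : ℝ}

theorem contourIntegral_eq (C : B.Collar c t₀) {W : ℂ → ℂ}
    (hW : ∀ ζ ∈ frontier D, ζ ∉ C.chart.target → W ζ = 0) :
    B.contourIntegral W =
      ∫ t in Ioo (t₀ - C.δ) (t₀ + C.δ), W (B.curve c t) * deriv (B.curve c) t := by
  have hother : ∀ c', c' ≠ c →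
      ∫ t in (0 : ℝ)..1, W (B.curve c' t) * deriv (B.curve c') t = 0 := fun c' hc' => by
    have : ∀ t, W (B.curve c' t) * deriv (B.curve c') t = 0 := fun t => by
      rw [hW _ (B.curve_mem_frontier c' t) (C.notMem_of_ne c' hc' t), zero_mul]
    simp [this]
  have hper : Function.Periodic (fun t => W (B.curve c t) * deriv (B.curve c) t) 1 := fun t => by
    have h1 : deriv (B.curve c) (t + 1) = deriv (B.curve c) t := by
      rw [← deriv_comp_add_const]
      congr 1
      exact funext (B.periodic c)
    simp only [B.periodic c t, h1]
  unfold contourIntegral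
  rw [Finset.sum_eq_single c (fun c' _ hc' => hother c' hc') (by simp)]
  have h2 := hper.intervalIntegral_add_eq 0 (t₀ - 1 / 2)
  rw [zero_add] at h2
  rw [h2, show t₀ - 1 / 2 + 1 = t₀ + 1 / 2 by ring,
    intervalIntegral.integral_of_le (by linarith)]
  have hδ := C.lt_half
  refine setIntegral_eq_of_subset_of_forall_sdiff_eq_zero measurableSet_Ioc
    (fun t ht => ⟨by linarith [ht.1], by linarith [ht.2]⟩) fun t ht => ?_
  rw [hW _ (B.curve_mem_frontier c t) fun h => ht.2
    (C.mem_Ioo t (Ioc_subset_Icc_self ht.1) h), zero_mul]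

/-- Green's formula `∫_{∂D} u dζ = 2i ∫_D ∂̄u dA` for a function supported in a collar. In the
coordinates `t + i s` of the collar, with `τ` the tangent at its centre and `J` the Jacobian,
`2i J ∂̄u = i τ ∂_t u - γ' ∂_s u`. The first term integrates to zero along horizontal lines, and the
second one to the boundary values of `u` along vertical lines. -/
theorem green (C : B.Collar c t₀) (hm : 1 ≤ m) (hD : IsOpen D) {u a b : ℂ → ℂ}
    (h : HasWirtingerOn D u a b) {K : Set ℂ} (hK : IsCompact K) (hKC : K ⊆ C.chart.target)
    (h0 : ∀ ζ ∈ D, ζ ∉ K → u ζ = 0) :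
    B.contourIntegral (extendFrom D u) = ∫ ζ in D, b ζ * (2 * Complex.I) := by
  set γ := B.curve c with hγdef
  have hγ : ContDiff ℝ 1 γ := B.contDiff_curve hm c
  set τ := deriv γ t₀ with hτ
  set Φ := collarMap γ t₀ with hΦ
  have hΦc : Continuous Φ := (contDiff_collarMap hγ t₀).continuous
  have hγ'c : Continuous (deriv γ) := hγ.continuous_deriv le_rfl
  have hδ := C.pos
  rw [C.contourIntegral_eq fun ζ hζ hζC =>
    extendFrom_eq_zero hK.isClosed h0 hζ fun hζK => hζC (hKC hζK)]
  -- `u ∘ Φ` vanishes near the part of the boundary of the half square off the real axis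
  have hvan : ∀ w₀, w₀ ∉ collarBox t₀ C.δ → ∀ᶠ w in 𝓝 w₀, w ∈ C.upper → u (Φ w) = 0 :=
    fun w₀ hw₀ => by
      have hK' : IsClosed (C.chart.symm '' K) :=
        (hK.image_of_continuousOn (C.chart.continuousOn_symm.mono hKC)).isClosed
      have h1 : w₀ ∉ C.chart.symm '' K := by
        rintro ⟨ζ, hζ, rfl⟩
        apply hw₀
        rw [← C.source_eq]
        exact C.chart.map_target (hKC hζ)
      filter_upwards [hK'.isOpen_compl.mem_nhds h1] with w hw hwU
      refine h0 _ (C.map_mem hwU) fun hwK => hw ⟨_, hwK, ?_⟩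
      rw [hΦ, ← C.coe_eq]
      exact C.chart.left_inv (by rw [C.source_eq]; exact C.upper_subset hwU)
  set S : Set (ℝ × ℝ) := Ioo (t₀ - C.δ) (t₀ + C.δ) ×ˢ Ioo 0 C.δ with hS
  have hSU : ∀ p ∈ S, (p.1 + p.2 * Complex.I : ℂ) ∈ C.upper := fun p hp =>
    ⟨by simpa using hp.1, by simpa using hp.2⟩
  set Ψ : ℝ × ℝ → ℂ := fun p => Φ (p.1 + p.2 * Complex.I) with hΨ
  have hpath : Continuous fun p : ℝ × ℝ => (p.1 + p.2 * Complex.I : ℂ) := by fun_prop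
  have hΨc : Continuous Ψ := hΦc.comp hpath
  have hΨm : MapsTo Ψ S D := fun p hp => C.map_mem (hSU p hp)
  have hA : BddContOn S fun p => a (Ψ p) := h.bddCont_d.comp hΨc.continuousOn hΨm
  have hB : BddContOn S fun p => b (Ψ p) := h.bddCont_dbar.comp hΨc.continuousOn hΨm
  obtain ⟨M, hM⟩ := (isCompact_Icc (a := t₀ - C.δ) (b := t₀ + C.δ)).exists_bound_of_continuousOn
    hγ'c.continuousOn
  have hG : BddContOn S fun p => deriv γ p.1 :=
    ⟨(hγ'c.comp continuous_fst).continuousOn, M, fun p hp => hM _ (Ioo_subset_Icc_self hp.1)⟩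
  have hG' : BddContOn S fun p => starRingEnd ℂ (deriv γ p.1) :=
    ⟨(Complex.continuous_conj.comp (hγ'c.comp continuous_fst)).continuousOn, M, fun p hp => by
      rw [RCLike.norm_conj]; exact hM _ (Ioo_subset_Icc_self hp.1)⟩
  set Vt : ℝ × ℝ → ℂ := fun p => a (Ψ p) * deriv γ p.1 + b (Ψ p) * starRingEnd ℂ (deriv γ p.1)
    with hVt
  set Vs : ℝ × ℝ → ℂ := fun p => a (Ψ p) * (Complex.I * τ) +
    b (Ψ p) * starRingEnd ℂ (Complex.I * τ) with hVs
  have hVtB : BddContOn S Vt := (hA.mul hG).add (hB.mul hG')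
  have hVsB : BddContOn S Vs := (hA.mul (.const _)).add (hB.mul (.const _))
  have hSm : MeasurableSet S := measurableSet_Ioo.prod measurableSet_Ioo
  have hSf : volume S ≠ ⊤ := by
    rw [hS, Measure.volume_eq_prod, Measure.prod_prod]
    simp [ENNReal.mul_eq_top]
  have hi1 : IntegrableOn (fun p => Complex.I * τ * Vt p) S :=
    (hVtB.const_mul _).integrableOn hSm hSf
  have hi2 : IntegrableOn (fun p => deriv γ p.1 * Vs p) S := (hG.mul hVsB).integrableOn hSm hSf
  have hdt : ∀ p ∈ S, HasDerivAt (fun t : ℝ => u (Ψ (t, p.2))) (Vt p) p.1 := fun p hp => by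
    have h1 : HasDerivAt (fun t : ℝ => (t + p.2 * Complex.I : ℂ)) 1 p.1 :=
      (hasDerivAt_id (p.1 : ℂ)).comp_ofReal.add_const _
    have h2 := (C.hasFDerivAt_comp hm h (hSU p hp)).comp_hasDerivAt p.1 h1
    refine HasDerivAt.congr_deriv (f := fun t : ℝ => u (Ψ (t, p.2))) h2 ?_
    simp [Vt, Ψ, Φ, γ]
  have hds : ∀ p ∈ S, HasDerivAt (fun s : ℝ => u (Ψ (p.1, s))) (Vs p) p.2 := fun p hp => by
    have h1 : HasDerivAt (fun s : ℝ => (p.1 + s * Complex.I : ℂ)) Complex.I p.2 := by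
      simpa using ((hasDerivAt_id (p.2 : ℂ)).mul_const Complex.I).comp_ofReal.const_add (p.1 : ℂ)
    have h2 := (C.hasFDerivAt_comp hm h (hSU p hp)).comp_hasDerivAt p.2 h1
    refine HasDerivAt.congr_deriv (f := fun s : ℝ => u (Ψ (p.1, s))) h2 ?_
    simp [Vs, Ψ, Φ, γ, τ]
  have hhor : ∫ p in S, Complex.I * τ * Vt p = 0 := by
    rw [hS, Measure.volume_eq_prod, ← Measure.prod_restrict]
    rw [hS, IntegrableOn, Measure.volume_eq_prod, ← Measure.prod_restrict] at hi1
    rw [integral_prod_symm _ hi1]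
    refine setIntegral_eq_zero_of_forall_eq_zero fun s hs => ?_
    rw [integral_const_mul, ← integral_Ioc_eq_integral_Ioo,
      ← intervalIntegral.integral_of_le (by linarith),
      intervalIntegral.integral_eq_sub_of_hasDerivAt_of_tendsto (f := fun t : ℝ => u (Ψ (t, s)))
        (fa := 0) (fb := 0) (by linarith) (fun t ht => hdt (t, s) ⟨ht, hs⟩), sub_self, mul_zero]
    · rw [intervalIntegrable_iff_integrableOn_Ioo_of_le (by linarith)]
      refine BddContOn.integrableOn (hVtB.comp (φ := fun t : ℝ => (t, s)) (by fun_prop)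
        fun t ht => ⟨ht, hs⟩) measurableSet_Ioo (by simp)
    · have h1 : Tendsto (fun t : ℝ => (t + s * Complex.I : ℂ)) (𝓝[>] (t₀ - C.δ))
          (𝓝 ((t₀ - C.δ : ℝ) + s * Complex.I)) :=
        (by fun_prop : Continuous fun t : ℝ => (t + s * Complex.I : ℂ)).continuousAt.tendsto
          |>.mono_left nhdsWithin_le_nhds
      have h2 := h1.eventually (hvan _ fun hmem => by
        have := hmem.1.1
        simp at this)
      refine tendsto_const_nhds.congr' ?_
      filter_upwards [h2, Ioo_mem_nhdsGT (show t₀ - C.δ < t₀ + C.δ by linarith)] with t h3 h4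
      exact (h3 (hSU (t, s) ⟨h4, hs⟩)).symm
    · have h1 : Tendsto (fun t : ℝ => (t + s * Complex.I : ℂ)) (𝓝[<] (t₀ + C.δ))
          (𝓝 ((t₀ + C.δ : ℝ) + s * Complex.I)) :=
        (by fun_prop : Continuous fun t : ℝ => (t + s * Complex.I : ℂ)).continuousAt.tendsto
          |>.mono_left nhdsWithin_le_nhds
      have h2 := h1.eventually (hvan _ fun hmem => by
        have := hmem.1.2
        simp at this)
      refine tendsto_const_nhds.congr' ?_
      filter_upwards [h2, Ioo_mem_nhdsLT (show t₀ - C.δ < t₀ + C.δ by linarith)] with t h3 h4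
      exact (h3 (hSU (t, s) ⟨h4, hs⟩)).symm
  have hver : ∫ p in S, deriv γ p.1 * Vs p =
      -∫ t in Ioo (t₀ - C.δ) (t₀ + C.δ), extendFrom D u (γ t) * deriv γ t := by
    rw [hS, Measure.volume_eq_prod, setIntegral_prod _ (by rwa [← Measure.volume_eq_prod]),
      ← integral_neg]
    refine setIntegral_congr_fun measurableSet_Ioo fun t ht => ?_
    simp only
    rw [integral_const_mul, ← integral_Ioc_eq_integral_Ioo,
      ← intervalIntegral.integral_of_le hδ.le,
      intervalIntegral.integral_eq_sub_of_hasDerivAt_of_tendsto (f := fun s : ℝ => u (Ψ (t, s)))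
        (fa := extendFrom D u (γ t)) (fb := 0) hδ (fun s hs => hds (t, s) ⟨ht, hs⟩)]
    · ring
    · rw [intervalIntegrable_iff_integrableOn_Ioo_of_le hδ.le]
      refine BddContOn.integrableOn (hVsB.comp (φ := fun s : ℝ => (t, s)) (by fun_prop)
        fun s hs => ⟨ht, hs⟩) measurableSet_Ioo (by simp)
    · refine (B.tendsto_extendFrom hm hD h (B.curve_mem_frontier c t)).comp
        (tendsto_nhdsWithin_iff.2 ⟨?_, ?_⟩)
      · have h1 : Continuous fun s : ℝ => Ψ (t, s) := hΨc.comp (by fun_prop)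
        have h2 := (h1.continuousAt (x := 0)).tendsto.mono_left
          (nhdsWithin_le_nhds (s := Ioi (0 : ℝ)))
        have h3 : Ψ (t, 0) = γ t := by simp [hΨ, hΦ]
        rwa [h3] at h2
      · filter_upwards [Ioo_mem_nhdsGT hδ] with s hs
        exact hΨm ⟨ht, hs⟩
    · have h1 : Tendsto (fun s : ℝ => (t + s * Complex.I : ℂ)) (𝓝[<] C.δ)
          (𝓝 (t + C.δ * Complex.I)) :=
        (by fun_prop : Continuous fun s : ℝ => (t + s * Complex.I : ℂ)).continuousAt.tendsto
          |>.mono_left nhdsWithin_le_nhds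
      have h2 := h1.eventually (hvan _ fun hmem => by
        have := hmem.2.2
        simp at this)
      refine tendsto_const_nhds.congr' ?_
      filter_upwards [h2, Ioo_mem_nhdsLT hδ] with s h3 h4
      exact (h3 (hSU (t, s) ⟨ht, h4⟩)).symm
  have hcov : ∫ ζ in D, b ζ * (2 * Complex.I) =
      ∫ p in S, (Complex.I * τ * Vt p - deriv γ p.1 * Vs p) := by
    have h1 : ∫ ζ in D, b ζ * (2 * Complex.I) = ∫ ζ in Φ '' C.upper, b ζ * (2 * Complex.I) := by
      rw [hΦ, C.image_upper]
      refine setIntegral_eq_of_subset_of_forall_sdiff_eq_zero hD.measurableSet inter_subset_left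
        fun ζ hζ => ?_
      rw [dbar_eq_zero_of_notMem hD h hK.isClosed h0 hζ.1 fun hζK => hζ.2 ⟨hζ.1, hKC hζK⟩, zero_mul]
    have hinj : InjOn Φ C.upper := by
      rw [hΦ, ← C.coe_eq]
      exact C.chart.injOn.mono (by rw [C.source_eq]; exact C.upper_subset)
    rw [h1, integral_image_eq_integral_abs_det_fderiv_smul volume C.isOpen_upper.measurableSet
      (fun w _ => (hasFDerivAt_collarMap hγ t₀ w).hasFDerivWithinAt) hinj]
    unfold upper
    rw [setIntegral_reProdIm]
    refine setIntegral_congr_fun hSm fun p hp => ?_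
    have hJ := C.jacobian_pos p.1 hp.1
    have hdet : (collarDeriv (deriv γ p.1) (Complex.I * τ)).det =
        (deriv γ p.1).re * τ.re + (deriv γ p.1).im * τ.im := by
      rw [det_collarDeriv]
      simp
    have hre : (p.1 + p.2 * Complex.I : ℂ).re = p.1 := by simp
    simp only [hre]
    rw [hdet, abs_of_pos hJ, Complex.real_smul]
    have hJ2 : (((deriv γ p.1).re * τ.re + (deriv γ p.1).im * τ.im : ℝ) : ℂ) =
        (deriv γ p.1 * starRingEnd ℂ τ + starRingEnd ℂ (deriv γ p.1) * τ) / 2 := by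
      apply Complex.ext <;> simp
      ring
    rw [hJ2]
    simp only [hVt, hVs, hΨ, map_mul, Complex.conj_I]
    ring
  rw [hcov, integral_sub hi1 hi2, hhor, hver]
  ring

end Collar

end PositiveBoundary

/-! ### The Cauchy–Pompeiu formula on a planar domain -/

/-- Division of `v` by `ζ - z`, where `v` vanishes near `z`, divides `∂̄v` by the same factor. -/
theorem HasWirtingerOn.div_sub {D : Set ℂ} (hD : IsOpen D) {v a b : ℂ → ℂ}
    (h : HasWirtingerOn D v a b) {K : Set ℂ} (hK : IsClosed K) (h0 : ∀ ζ ∈ D, ζ ∉ K → v ζ = 0)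
    {z : ℂ} (hz : z ∉ K) :
    ∃ a', HasWirtingerOn D (fun ζ => v ζ / (ζ - z)) a' fun ζ => b ζ / (ζ - z) := by
  obtain ⟨r, hr, hrK⟩ := Metric.mem_nhds_iff.1 (hK.isOpen_compl.mem_nhds hz)
  set V : Set ℂ := {ζ | r / 2 < ‖ζ - z‖}
  have hV : IsOpen V := isOpen_lt continuous_const (by fun_prop)
  have hVW : V ∪ Metric.ball z r = univ := by
    refine eq_univ_of_forall fun ζ => ?_
    by_cases h : r / 2 < ‖ζ - z‖
    · exact Or.inl h
    · right
      rw [Metric.mem_ball, dist_eq_norm]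
      linarith
  have hne : ∀ ζ ∈ V, ζ - z ≠ 0 := fun ζ hζ => by
    have : 0 < ‖ζ - z‖ := (by positivity : 0 < r / 2).trans hζ
    exact norm_pos_iff.1 this
  have hκ : BddContOn V fun ζ => (ζ - z)⁻¹ := by
    refine ⟨ContinuousOn.inv₀ (by fun_prop) hne, (r / 2)⁻¹, fun ζ hζ => ?_⟩
    rw [norm_inv]
    exact inv_anti₀ (by positivity) (le_of_lt hζ)
  have hκW : HasWirtingerOn V (fun ζ => (ζ - z)⁻¹) (fun ζ => -1 * ((ζ - z)⁻¹ * (ζ - z)⁻¹))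
      fun _ => 0 := by
    refine ⟨hκ, (hκ.mul hκ).const_mul _, .const 0, fun ζ hζ => ?_⟩
    have h1 := (((hasDerivAt_id ζ).sub_const z).inv (hne ζ hζ)).hasFDerivAt.restrictScalars ℝ
    refine h1.congr_fderiv ?_
    ext w
    simp
    field_simp
  have hW : ∀ ζ ∈ D ∩ Metric.ball z r, v =ᶠ[𝓝 ζ] fun _ => 0 := fun ζ hζ => by
    filter_upwards [(hD.inter Metric.isOpen_ball).mem_nhds hζ] with w hw
    exact h0 w hw.1 (hrK hw.2)
  refine ⟨fun ζ => v ζ * (-1 * ((ζ - z)⁻¹ * (ζ - z)⁻¹)) + (ζ - z)⁻¹ * a ζ, HasWirtingerOn.of_cover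
    hD hV Metric.isOpen_ball hVW (((h.mono inter_subset_left).mul
      (hκW.mono inter_subset_right)).congr (hD.inter hV) (fun ζ _ => div_eq_mul_inv _ _)
      (fun ζ _ => rfl) fun ζ _ => by ring) (fun ζ hζ => ?_) (fun ζ hζ => ?_) fun ζ hζ => ?_⟩
  · simp [(hW ζ hζ).eq_of_nhds]
  · simp [(hW ζ hζ).eq_of_nhds, h.d_eq_zero hζ.1 (hW ζ hζ)]
  · simp [h.dbar_eq_zero hζ.1 (hW ζ hζ)]

namespace PositiveBoundary

variable {m : ℕ} {α : ℝ} {D : Set ℂ}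

theorem contourIntegral_congr (B : PositiveBoundary m α D) {g h : ℂ → ℂ}
    (hgh : EqOn g h (frontier D)) : B.contourIntegral g = B.contourIntegral h := by
  unfold contourIntegral
  refine Finset.sum_congr rfl fun c _ => ?_
  congr 1 with t
  rw [hgh (B.curve_mem_frontier c t)]

theorem intervalIntegrable (B : PositiveBoundary m α D) (hm : 1 ≤ m) {g : ℂ → ℂ}
    (hg : ContinuousOn g (frontier D)) (c : Fin B.N) :
    IntervalIntegrable (fun t => g (B.curve c t) * deriv (B.curve c) t) volume 0 1 := by
  have hγ := B.contDiff_curve hm c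
  exact ((hg.comp_continuous hγ.continuous (B.curve_mem_frontier c)).mul
    (hγ.continuous_deriv le_rfl)).intervalIntegrable 0 1

theorem contourIntegral_sum (B : PositiveBoundary m α D) (hm : 1 ≤ m) {ι : Type*} (s : Finset ι)
    {g : ι → ℂ → ℂ} (hg : ∀ i ∈ s, ContinuousOn (g i) (frontier D)) :
    B.contourIntegral (fun ζ => ∑ i ∈ s, g i ζ) = ∑ i ∈ s, B.contourIntegral (g i) := by
  unfold contourIntegral
  rw [Finset.sum_comm]
  refine Finset.sum_congr rfl fun c _ => ?_
  simp only [Finset.sum_mul]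
  exact intervalIntegral.integral_finsetSum fun i hi => B.intervalIntegrable hm (hg i hi) c

/-- The Cauchy–Pompeiu formula at the point `z` for the function `v` with `∂̄v = b`; on the boundary
the values of `v` are the limits from inside `D`. -/
def PompeiuFormula (B : PositiveBoundary m α D) (z : ℂ) (v b : ℂ → ℂ) : Prop :=
  B.contourIntegral (fun ζ => extendFrom D v ζ / (ζ - z)) =
    2 * Real.pi * Complex.I * v z + ∫ ζ in D, b ζ / (ζ - z) * (2 * Complex.I)

/-- The Cauchy–Pompeiu formula for functions supported in a compact subset of the domain: the
extension by zero reduces it to the formula on the plane. -/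
theorem pompeiuFormula_of_compact (B : PositiveBoundary m α D) (hD : IsOpen D) {z : ℂ}
    (hz : z ∈ D) {v a b : ℂ → ℂ} (h : HasWirtingerOn D v a b) {K : Set ℂ} (hK : IsCompact K)
    (hKD : K ⊆ D) (h0 : ∀ ζ ∈ D, ζ ∉ K → v ζ = 0) : B.PompeiuFormula z v b := by
  have hcover : D ∪ Kᶜ = univ := by
    refine eq_univ_of_forall fun ζ => ?_
    by_cases hζ : ζ ∈ K
    · exact Or.inl (hKD hζ)
    · exact Or.inr hζ
  have hloc : ∀ ζ ∈ D, ζ ∉ K → v =ᶠ[𝓝 ζ] fun _ => 0 := fun ζ hζ hζK => by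
    filter_upwards [(hD.inter hK.isClosed.isOpen_compl).mem_nhds ⟨hζ, hζK⟩] with w hw
    exact h0 w hw.1 hw.2
  have hind : ∀ {g : ℂ → ℂ}, (∀ ζ ∈ D, ζ ∉ K → g ζ = 0) →
      ∀ ζ ∈ univ ∩ Kᶜ, indicator D g ζ = 0 := fun hg ζ hζ => by
    by_cases hζD : ζ ∈ D
    · rw [indicator_of_mem hζD, hg ζ hζD hζ.2]
    · exact indicator_of_notMem hζD _
  have hfull : HasWirtingerOn univ (indicator D v) (indicator D a) (indicator D b) := by
    refine .of_cover isOpen_univ hD hK.isClosed.isOpen_compl hcover ?_ (hind h0)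
      (hind fun ζ hζ hζK => h.d_eq_zero hζ (hloc ζ hζ hζK))
      (hind fun ζ hζ hζK => h.dbar_eq_zero hζ (hloc ζ hζ hζK))
    rw [univ_inter]
    exact h.congr hD (fun ζ hζ => indicator_of_mem hζ _) (fun ζ hζ => indicator_of_mem hζ _)
      fun ζ hζ => indicator_of_mem hζ _
  have hsupp : HasCompactSupport (indicator D v) := by
    refine HasCompactSupport.intro hK fun ζ hζ => hind h0 ζ ⟨mem_univ ζ, hζ⟩
  have hplane := integral_dbar_div_sub hfull hsupp z
  have h1 : ∫ ζ, indicator D b ζ / (ζ - z) = ∫ ζ in D, b ζ / (ζ - z) := by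
    rw [← integral_indicator hD.measurableSet]
    congr 1 with ζ
    by_cases hζ : ζ ∈ D <;> simp [hζ]
  rw [h1, indicator_of_mem hz] at hplane
  have h2 : B.contourIntegral (fun ζ => extendFrom D v ζ / (ζ - z)) = 0 := by
    rw [B.contourIntegral_congr (h := fun _ => 0)]
    · simp [contourIntegral]
    · intro ζ hζ
      have hζD : ζ ∉ D := by
        rw [hD.frontier_eq] at hζ
        exact hζ.2
      simp [extendFrom_eq_zero hK.isClosed h0 hζ fun hζK => hζD (hKD hζK)]
  rw [PompeiuFormula, h2, integral_mul_const, hplane]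
  ring

/-- The Cauchy–Pompeiu formula for functions supported in a collar, away from `z`: it is Green's
formula for `v / (ζ - z)`. -/
theorem Collar.pompeiuFormula {B : PositiveBoundary m α D} {c : Fin B.N} {t₀ : ℝ}
    (C : B.Collar c t₀) (hm : 1 ≤ m) (hD : IsOpen D) {z : ℂ} (hz : z ∈ D) {v a b : ℂ → ℂ}
    (h : HasWirtingerOn D v a b) {K : Set ℂ} (hK : IsCompact K) (hKC : K ⊆ C.chart.target)
    (hzK : z ∉ K) (h0 : ∀ ζ ∈ D, ζ ∉ K → v ζ = 0) : B.PompeiuFormula z v b := by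
  obtain ⟨a', h'⟩ := h.div_sub hD hK.isClosed h0 hzK
  have hgreen := C.green hm hD h' hK hKC fun ζ hζ hζK => by rw [h0 ζ hζ hζK, zero_div]
  rw [PompeiuFormula, h0 z hz hzK, mul_zero, zero_add, ← hgreen]
  refine B.contourIntegral_congr fun ζ hζ => ?_
  have hne : ζ - z ≠ 0 := sub_ne_zero.2 fun h => by
    rw [hD.frontier_eq] at hζ
    exact hζ.2 (h ▸ hz)
  refine (extendFrom_eq hζ.1 ((B.tendsto_extendFrom hm hD h hζ).div ?_ hne)).symm
  exact (by fun_prop : Continuous fun ζ : ℂ => ζ - z).continuousAt.tendsto.mono_left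
    nhdsWithin_le_nhds

/-- The Cauchy–Pompeiu formula. A partition of unity on the closure of the domain reduces it to
functions supported in the domain or in a collar of the boundary. -/
theorem pompeiuFormula (B : PositiveBoundary m α D) (hm : 1 ≤ m) (hD : IsOpen D)
    (hDb : Bornology.IsBounded D) {z : ℂ} (hz : z ∈ D) {u a b : ℂ → ℂ}
    (h : HasWirtingerOn D u a b) : B.PompeiuFormula z u b := by
  have hlocal : ∀ x : closure D, ∃ U : Set ℂ, IsOpen U ∧ (x : ℂ) ∈ U ∧
      ∀ v a b K, HasWirtingerOn D v a b → IsCompact K → K ⊆ U → (∀ ζ ∈ D, ζ ∉ K → v ζ = 0) →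
        B.PompeiuFormula z v b := fun ⟨x, hx⟩ => by
    by_cases hxD : x ∈ D
    · exact ⟨D, hD, hxD, fun v a b K hv hK hKD h0 => B.pompeiuFormula_of_compact hD hz hv hK hKD h0⟩
    · have hxf : x ∈ frontier D := ⟨hx, by rwa [hD.interior_eq]⟩
      rw [← B.iUnion_range, mem_iUnion] at hxf
      obtain ⟨c, t₀, rfl⟩ := hxf
      obtain ⟨C⟩ := B.nonempty_collar hm hD c t₀
      refine ⟨C.chart.target \ {z}, C.chart.open_target.sdiff isClosed_singleton,
        ⟨C.curve_mem_target ⟨by linarith [C.pos], by linarith [C.pos]⟩, fun h => hxD ?_⟩,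
        fun v a b K hv hK hKU h0 => C.pompeiuFormula hm hD hz hv hK (hKU.trans sdiff_subset)
          (fun hzK => (hKU hzK).2 rfl) h0⟩
      have h' : B.curve c t₀ = z := h
      rwa [h']
  choose U hUo hUx hU using hlocal
  have hcomp : IsCompact (closure D) := hDb.isCompact_closure
  obtain ⟨t, ht⟩ := hcomp.elim_finite_subcover U hUo fun x hx => mem_iUnion.2 ⟨⟨x, hx⟩, hUx _⟩
  obtain ⟨χ, hχ⟩ := SmoothPartitionOfUnity.exists_isSubordinate (modelWithCornersSelf ℝ ℂ)
    (isClosed_closure (s := D)) (fun i : t => U i) (fun i => hUo i) fun x hx => by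
      simpa using ht hx
  have hχs : ∀ i, ContDiff ℝ 1 fun ζ => (χ i ζ : ℂ) := fun i =>
    Complex.ofRealCLM.contDiff.comp ((χ i).contMDiff.contDiff.of_le (by exact_mod_cast le_top))
  choose p q hpq using fun i => exists_hasWirtingerOn_of_contDiff (hχs i) hDb
  have hpiece := fun i => (hpq i).mul h
  have hsum1 : ∀ ζ ∈ closure D, ∑ i, (χ i ζ : ℂ) = 1 := fun ζ hζ => by
    have h1 := χ.sum_eq_one hζ
    rw [finsum_eq_sum_of_fintype] at h1
    exact_mod_cast h1
  have hformula : ∀ i, B.PompeiuFormula z (fun ζ => (χ i ζ : ℂ) * u ζ)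
      (fun ζ => (χ i ζ : ℂ) * b ζ + u ζ * q i ζ) := fun i => by
    refine hU i _ _ _ (tsupport (χ i) ∩ closure D) (hpiece i)
      (hcomp.inter_left (isClosed_tsupport _)) (inter_subset_left.trans (hχ i)) fun ζ hζ hζK => ?_
    rw [image_eq_zero_of_notMem_tsupport fun hmem => hζK ⟨hmem, subset_closure hζ⟩]
    simp
  have hsumu : EqOn (fun ζ => ∑ i, (χ i ζ : ℂ) * u ζ) u D := fun ζ hζ => by
    simp only
    rw [← Finset.sum_mul, hsum1 ζ (subset_closure hζ), one_mul]
  -- the terms with derivatives of the partition functions cancel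
  have hsumb : EqOn (fun ζ => ∑ i, ((χ i ζ : ℂ) * b ζ + u ζ * q i ζ)) b D :=
    (HasWirtingerOn.sum Finset.univ fun i _ => hpiece i).dbar_eqOn hD h hsumu
  have hne : ∀ ζ ∈ frontier D, ζ - z ≠ 0 := fun ζ hζ => sub_ne_zero.2 fun h => by
    rw [hD.frontier_eq] at hζ
    exact hζ.2 (h ▸ hz)
  have hcontour : B.contourIntegral (fun ζ => extendFrom D u ζ / (ζ - z)) =
      ∑ i, B.contourIntegral fun ζ => extendFrom D (fun ζ => (χ i ζ : ℂ) * u ζ) ζ / (ζ - z) := by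
    rw [← B.contourIntegral_sum hm]
    · refine B.contourIntegral_congr fun ζ hζ => ?_
      rw [← Finset.sum_div]
      congr 1
      refine extendFrom_eq hζ.1 (Tendsto.congr' ?_ (tendsto_finsetSum Finset.univ fun i _ =>
        B.tendsto_extendFrom hm hD (hpiece i) hζ))
      exact eventually_mem_nhdsWithin.mono fun w hw => hsumu hw
    · exact fun i _ => ((B.continuousOn_extendFrom hm hD (hpiece i)).mono
        frontier_subset_closure).div (by fun_prop) hne
  have hsolid : ∫ ζ in D, b ζ / (ζ - z) * (2 * Complex.I) =
      ∑ i, ∫ ζ in D, ((χ i ζ : ℂ) * b ζ + u ζ * q i ζ) / (ζ - z) * (2 * Complex.I) := by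
    rw [← integral_finsetSum]
    · refine setIntegral_congr_fun hD.measurableSet fun ζ hζ => ?_
      have hbζ : ∑ i, ((χ i ζ : ℂ) * b ζ + u ζ * q i ζ) = b ζ := hsumb hζ
      rw [← Finset.sum_mul, ← Finset.sum_div, hbζ]
    · exact fun i _ => ((hpiece i).bddCont_dbar.integrableOn_div_sub hD hDb z).mul_const _
  rw [PompeiuFormula, hcontour, hsolid, Finset.sum_congr rfl fun i _ => hformula i,
    Finset.sum_add_distrib, ← Finset.mul_sum]
  congr 2
  exact hsumu hz

end PositiveBoundary

/-! ### The boundary Cauchy transform on a product domain -/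

theorem extendFrom_congr {X Y : Type*} [TopologicalSpace X] [TopologicalSpace Y] {A : Set X}
    {f g : X → Y} (h : EqOn f g A) (x : X) : extendFrom A f x = extendFrom A g x := by
  have h1 : map f (𝓝[A] x) = map g (𝓝[A] x) :=
    map_congr (eventually_mem_nhdsWithin.mono h)
  unfold extendFrom limUnder
  rw [h1]

section BoundaryCauchy

variable {n m : ℕ} {α : ℝ} {D : Fin n → Set ℂ} {B : ∀ j, PositiveBoundary m α (D j)}

theorem sliceExt_congr {g h : (Fin n → ℂ) → ℂ} (hgh : EqOn g h (univ.pi D)) (j : Fin n)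
    {z : Fin n → ℂ} (hz : z ∈ univ.pi D) : sliceExt D j g z = sliceExt D j h z :=
  funext fun ζ => extendFrom_congr (fun _ hw => hgh (update_mem_pi hz hw)) ζ

theorem boundaryCauchy_congr {g h : (Fin n → ℂ) → ℂ} (hgh : EqOn g h (univ.pi D)) (j : Fin n) :
    EqOn (boundaryCauchy B j g) (boundaryCauchy B j h) (univ.pi D) := fun z hz => by
  unfold boundaryCauchy
  rw [sliceExt_congr hgh j hz]

theorem boundaryCauchyConverges_congr {g h : (Fin n → ℂ) → ℂ} (hgh : EqOn g h (univ.pi D))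
    {j : Fin n} (hh : BoundaryCauchyConverges B j h) : BoundaryCauchyConverges B j g :=
  fun z hz => by
    obtain ⟨h1, h2⟩ := hh z hz
    refine ⟨fun ζ hζ => ?_, fun c => ?_⟩
    · obtain ⟨a, ha⟩ := h1 ζ hζ
      exact ⟨a, ha.congr' (eventually_mem_nhdsWithin.mono fun w hw =>
        (hgh (update_mem_pi hz hw)).symm)⟩
    · rw [sliceExt_congr hgh j hz]
      exact h2 c

theorem HasSliceWirtinger.boundaryCauchyConverges (hm : 1 ≤ m) (hDo : ∀ j, IsOpen (D j))
    {l : Fin n} {g a b : (Fin n → ℂ) → ℂ} (h : HasSliceWirtinger D l g a b) :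
    BoundaryCauchyConverges B l g := fun z hz => by
  have h1 := h.hasWirtingerOn hz
  refine ⟨fun ζ hζ => (B l).exists_tendsto hm (hDo l) h1 hζ, fun c => ?_⟩
  refine (B l).intervalIntegrable hm (g := fun ζ => sliceExt D l g z ζ / (ζ - z l)) ?_ c
  refine (((B l).continuousOn_extendFrom hm (hDo l) h1).mono frontier_subset_closure).div
    (by fun_prop) fun ζ hζ => sub_ne_zero.2 fun h => ?_
  rw [(hDo l).frontier_eq] at hζ
  exact hζ.2 (h ▸ hz l trivial)

/-- `S_l = 1 - T_l ∂̄_l`: the Cauchy–Pompeiu formula in the `l`-th variable. -/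
theorem HasSliceWirtinger.boundaryCauchy_eq (hm : 1 ≤ m) (hDo : ∀ j, IsOpen (D j))
    (hDb : ∀ j, Bornology.IsBounded (D j)) {l : Fin n} {g a b : (Fin n → ℂ) → ℂ}
    (h : HasSliceWirtinger D l g a b) {z : Fin n → ℂ} (hz : z ∈ univ.pi D) :
    boundaryCauchy B l g z = g z - _root_.solidCauchy D l b z := by
  have h1 := (B l).pompeiuFormula hm (hDo l) (hDb l) (hz l trivial) (h.hasWirtingerOn hz)
  rw [PositiveBoundary.PompeiuFormula, Function.update_eq_self] at h1
  have hpi : (2 * Real.pi * Complex.I : ℂ) ≠ 0 := by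
    simp [Real.pi_ne_zero]
  unfold boundaryCauchy sliceExt _root_.solidCauchy
  rw [h1, mul_add, ← mul_assoc, one_div_mul_cancel hpi]
  ring

end BoundaryCauchy

/-! ### Smooth functions with bounded derivatives -/

/-- The function `g` is of class `C^k` on `U`, and its derivatives of order at most `k` are
bounded. -/
def BddContDiffOn {E : Type*} [NormedAddCommGroup E] [NormedSpace ℝ E] (k : ℕ) (U : Set E)
    (g : E → ℂ) : Prop :=
  ContDiffOn ℝ k g U ∧ ∀ i ≤ k, ∃ C : ℝ, ∀ x ∈ U, ‖iteratedFDeriv ℝ i g x‖ ≤ C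

namespace BddContDiffOn

variable {E : Type*} [NormedAddCommGroup E] [NormedSpace ℝ E] {k : ℕ} {U : Set E} {g : E → ℂ}

theorem bddContOn (h : BddContDiffOn k U g) : BddContOn U g := by
  obtain ⟨C, hC⟩ := h.2 0 (Nat.zero_le k)
  exact ⟨h.1.continuousOn, C, fun x hx => by simpa using hC x hx⟩

theorem of_le {k' : ℕ} (h : BddContDiffOn k U g) (hk : k' ≤ k) : BddContDiffOn k' U g :=
  ⟨h.1.of_le (by exact_mod_cast hk), fun i hi => h.2 i (hi.trans hk)⟩

theorem clm_comp_fderiv (hU : IsOpen U) (h : BddContDiffOn (k + 1) U g)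
    (L : (E →L[ℝ] ℂ) →L[ℝ] ℂ) : BddContDiffOn k U fun x => L (fderiv ℝ g x) := by
  have h1 : ContDiffOn ℝ k (fderiv ℝ g) U := h.1.fderiv_of_isOpen hU (by norm_cast)
  refine ⟨L.contDiff.comp_contDiffOn h1, fun i hi => ?_⟩
  obtain ⟨C, hC⟩ := h.2 (i + 1) (by omega)
  refine ⟨‖L‖ * C, fun x hx => ?_⟩
  refine (L.norm_iteratedFDeriv_comp_left (h1.contDiffAt (hU.mem_nhds hx))
    (by exact_mod_cast hi)).trans ?_
  rw [norm_iteratedFDeriv_fderiv]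
  exact mul_le_mul_of_nonneg_left (hC x hx) (norm_nonneg _)

end BddContDiffOn

section Slices

variable {n : ℕ} {D : Fin n → Set ℂ}

theorem isOpen_univ_pi (hDo : ∀ j, IsOpen (D j)) : IsOpen (univ.pi D) :=
  isOpen_set_pi finite_univ fun j _ => hDo j

theorem BddContDiffOn.dbar (hDo : ∀ j, IsOpen (D j)) {k : ℕ} {g : (Fin n → ℂ) → ℂ}
    (h : BddContDiffOn (k + 1) (univ.pi D) g) (j : Fin n) :
    BddContDiffOn k (univ.pi D) (dbar j g) :=
  h.clm_comp_fderiv (isOpen_univ_pi hDo) ((1 / 2 : ℂ) •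
    (ContinuousLinearMap.apply ℝ ℂ (Pi.single j 1 : Fin n → ℂ) +
      Complex.I • ContinuousLinearMap.apply ℝ ℂ (Pi.single j Complex.I : Fin n → ℂ)))

theorem BddContDiffOn.exists_hasSliceWirtinger (hDo : ∀ j, IsOpen (D j)) {k : ℕ}
    {g : (Fin n → ℂ) → ℂ} (h : BddContDiffOn (k + 1) (univ.pi D) g) (l : Fin n) :
    ∃ a, HasSliceWirtinger D l g a (_root_.dbar l g) := by
  have h1 := h.clm_comp_fderiv (isOpen_univ_pi hDo) ((1 / 2 : ℂ) •
    (ContinuousLinearMap.apply ℝ ℂ (Pi.single l 1 : Fin n → ℂ) -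
      Complex.I • ContinuousLinearMap.apply ℝ ℂ (Pi.single l Complex.I : Fin n → ℂ)))
  refine ⟨_, h.bddContOn, h1.bddContOn, (h.dbar hDo l).bddContOn, fun z hz => ?_⟩
  have h2 : HasFDerivAt g (fderiv ℝ g z) (Function.update z l (z l)) := by
    rw [Function.update_eq_self]
    exact ((h.1.contDiffAt ((isOpen_univ_pi hDo).mem_nhds hz)).differentiableAt
      (by simp)).hasFDerivAt
  refine (h2.comp (z l) (hasFDerivAt_update z (z l))).congr_fderiv ?_
  refine (eq_wirtinger _).trans ?_
  have hs : ∀ c : ℂ, (fun i => (Pi.single l (ContinuousLinearMap.id ℝ ℂ) : Fin n → ℂ →L[ℝ] ℂ) i c) =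
      Pi.single l c := fun c => funext fun i => by
    rcases eq_or_ne i l with rfl | h
    · simp
    · simp [h]
  congr 1 <;> simp [_root_.dbar, hs]

theorem BddContDiffOn.iterOp_dbar (hDo : ∀ j, IsOpen (D j)) {k : ℕ} {g : (Fin n → ℂ) → ℂ}
    {I : List (Fin n)} (h : BddContDiffOn (k + I.length) (univ.pi D) g) :
    BddContDiffOn k (univ.pi D) (iterOp _root_.dbar I g) := by
  induction I generalizing k with
  | nil => exact h
  | cons i I ih =>
    refine BddContDiffOn.dbar hDo (ih ?_) i
    convert h using 1
    simp
    ring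

/-! ### Iterated transforms -/

theorem BddContOn.iterOp_solidCauchy (hDo : ∀ j, IsOpen (D j))
    (hDb : ∀ j, Bornology.IsBounded (D j)) (hDf : ∀ j, volume (frontier (D j)) = 0)
    {g : (Fin n → ℂ) → ℂ} (hg : BddContOn (univ.pi D) g) (I : List (Fin n)) :
    BddContOn (univ.pi D) (iterOp (_root_.solidCauchy D) I g) := by
  induction I with
  | nil => exact hg
  | cons i I ih => exact ih.solidCauchy hDo hDb hDf i

theorem HasSliceWirtinger.iterOp_solidCauchy (hDo : ∀ j, IsOpen (D j))
    (hDb : ∀ j, Bornology.IsBounded (D j)) (hDf : ∀ j, volume (frontier (D j)) = 0) {l : Fin n}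
    {g a b : (Fin n → ℂ) → ℂ} (h : HasSliceWirtinger D l g a b) {I : List (Fin n)} (hl : l ∉ I) :
    HasSliceWirtinger D l (iterOp (_root_.solidCauchy D) I g) (iterOp (_root_.solidCauchy D) I a)
      (iterOp (_root_.solidCauchy D) I b) := by
  induction I with
  | nil => exact h
  | cons i I ih =>
    rw [List.mem_cons, not_or] at hl
    exact (ih hl.2).solidCauchy hDo hDb hDf (Ne.symm hl.1)

theorem solidCauchy_iterOp_comm (hDo : ∀ j, IsOpen (D j)) (hDb : ∀ j, Bornology.IsBounded (D j))
    (hDf : ∀ j, volume (frontier (D j)) = 0) {g : (Fin n → ℂ) → ℂ}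
    (hg : BddContOn (univ.pi D) g) {j : Fin n} {I : List (Fin n)} (hj : j ∉ I) :
    EqOn (solidCauchy D j (iterOp (solidCauchy D) I g)) (iterOp (solidCauchy D) (I ++ [j]) g)
      (univ.pi D) := by
  induction I with
  | nil => exact fun z _ => rfl
  | cons i I ih =>
    rw [List.mem_cons, not_or] at hj
    intro z hz
    exact (solidCauchy_comm hDo hDb (Ne.symm hj.1)
      (hg.iterOp_solidCauchy hDo hDb hDf I) hz).trans (solidCauchy_congr hDo (ih hj.2) i hz)

end Slices

section Expansion

variable {n m : ℕ} {α : ℝ} {D : Fin n → Set ℂ}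

/-- The term of the expansion of `S_{l₁} ⋯ S_{l_s} f` that belongs to the indices `I`. -/
def expansionTerm (D : Fin n → Set ℂ) (f : (Fin n → ℂ) → ℂ) (I : List (Fin n)) :
    (Fin n → ℂ) → ℂ :=
  iterOp (solidCauchy D) I (iterOp dbar I f)

theorem bddContOn_expansionTerm (hDo : ∀ j, IsOpen (D j)) (hDb : ∀ j, Bornology.IsBounded (D j))
    (hDf : ∀ j, volume (frontier (D j)) = 0) {k : ℕ} {f : (Fin n → ℂ) → ℂ}
    (hf : BddContDiffOn k (univ.pi D) f) {I : List (Fin n)} (hI : I.length ≤ k) :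
    BddContOn (univ.pi D) (expansionTerm D f I) :=
  BddContOn.iterOp_solidCauchy hDo hDb hDf
    (BddContDiffOn.iterOp_dbar (k := 0) hDo (hf.of_le (by omega))).bddContOn I

theorem exists_hasSliceWirtinger_expansionTerm (hDo : ∀ j, IsOpen (D j))
    (hDb : ∀ j, Bornology.IsBounded (D j)) (hDf : ∀ j, volume (frontier (D j)) = 0) {k : ℕ}
    {f : (Fin n → ℂ) → ℂ} (hf : BddContDiffOn k (univ.pi D) f) {l : Fin n} {I : List (Fin n)}
    (hI : I.length < k) (hl : l ∉ I) :
    ∃ a, HasSliceWirtinger D l (expansionTerm D f I) a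
      (iterOp (solidCauchy D) I (iterOp dbar (l :: I) f)) := by
  obtain ⟨a, ha⟩ := BddContDiffOn.exists_hasSliceWirtinger (k := 0) hDo
    (BddContDiffOn.iterOp_dbar (I := I) hDo (hf.of_le (by omega))) l
  exact ⟨_, ha.iterOp_solidCauchy hDo hDb hDf hl⟩

/-- The sum over the sublists of `l :: L` splits according to whether `l` occurs. -/
theorem sum_sublists'_cons {ι : Type*} [DecidableEq ι] {l : ι} {L : List ι} (h : (l :: L).Nodup)
    (F : List ι → ℂ) : ∑ I ∈ (l :: L).sublists'.toFinset, F I =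
      ∑ I ∈ L.sublists'.toFinset, F I + ∑ I ∈ L.sublists'.toFinset, F (l :: I) := by
  have hL : L.sublists'.Nodup := List.nodup_sublists'.2 (List.nodup_cons.1 h).2
  have hlL : (l :: L).sublists'.Nodup := List.nodup_sublists'.2 h
  have h1 := List.sum_toFinset F hlL
  have h2 := List.sum_toFinset F hL
  have h3 := List.sum_toFinset (fun I => F (l :: I)) hL
  rw [h1, h2, h3, List.sublists'_cons, List.map_append, List.sum_append, List.map_map]
  rfl

variable {B : ∀ j, PositiveBoundary m α (D j)}

theorem exists_hasSliceWirtinger_expansion (hDo : ∀ j, IsOpen (D j))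
    (hDb : ∀ j, Bornology.IsBounded (D j)) (hDf : ∀ j, volume (frontier (D j)) = 0) {k : ℕ}
    {f : (Fin n → ℂ) → ℂ} (hf : BddContDiffOn k (univ.pi D) f) {l : Fin n} {L : List (Fin n)}
    (hL : L.length < k) (hl : l ∉ L) :
    ∃ a, HasSliceWirtinger D l
      (fun z => ∑ I ∈ L.sublists'.toFinset, (-1) ^ I.length * expansionTerm D f I z) a
      (fun z => ∑ I ∈ L.sublists'.toFinset, (-1) ^ I.length *
        iterOp (solidCauchy D) I (iterOp dbar (l :: I) f) z) := by
  have h : ∀ I ∈ L.sublists'.toFinset, ∃ a, HasSliceWirtinger D l (expansionTerm D f I) a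
      (iterOp (solidCauchy D) I (iterOp dbar (l :: I) f)) := fun I hI => by
    rw [List.mem_toFinset, List.mem_sublists'] at hI
    exact exists_hasSliceWirtinger_expansionTerm hDo hDb hDf hf (hI.length_le.trans_lt hL)
      fun hmem => hl (hI.subset hmem)
  choose! a ha using h
  exact ⟨_, HasSliceWirtinger.sum _ (fun I => (-1) ^ I.length) ha⟩

/-- The product of the operators `S_l = 1 - T_l ∂̄_l`, expanded. As `∂̄_l` commutes with the
transforms `T_i` for `i ≠ l`, all derivatives end up innermost. -/
theorem iterOp_boundaryCauchy_eqOn (hm : 1 ≤ m) (hDo : ∀ j, IsOpen (D j))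
    (hDb : ∀ j, Bornology.IsBounded (D j)) {k : ℕ}
    {f : (Fin n → ℂ) → ℂ} (hf : BddContDiffOn k (univ.pi D) f) {L : List (Fin n)}
    (hL : L.Nodup) (hLk : L.length ≤ k) :
    EqOn (iterOp (boundaryCauchy B) L f)
      (fun z => ∑ I ∈ L.sublists'.toFinset, (-1) ^ I.length * expansionTerm D f I z)
      (univ.pi D) := by
  have hDf : ∀ j, volume (frontier (D j)) = 0 := fun j => (B j).volume_frontier hm
  induction L with
  | nil => intro z _; simp [expansionTerm, iterOp]
  | cons l L ih =>
    intro z hz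
    have hl : l ∉ L := (List.nodup_cons.1 hL).1
    rw [List.length_cons] at hLk
    obtain ⟨a, ha⟩ := exists_hasSliceWirtinger_expansion hDo hDb hDf hf (l := l)
      (by omega : L.length < k) hl
    have h1 : iterOp (boundaryCauchy B) (l :: L) f z =
        boundaryCauchy B l (iterOp (boundaryCauchy B) L f) z := rfl
    rw [h1, boundaryCauchy_congr (ih (List.nodup_cons.1 hL).2 (by omega)) l hz,
      ha.boundaryCauchy_eq hm hDo hDb hz, solidCauchy_sum hDo hDb _ _ _ l hz, sub_eq_add_neg,
      ← Finset.sum_neg_distrib]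
    · refine Eq.trans ?_ (sum_sublists'_cons hL _).symm
      congr 1
      refine Finset.sum_congr rfl fun I _ => ?_
      have h2 : expansionTerm D f (l :: I) z =
        solidCauchy D l (iterOp (solidCauchy D) I (iterOp dbar (l :: I) f)) z := rfl
      rw [h2, List.length_cons]
      ring
    · intro I hI
      rw [List.mem_toFinset, List.mem_sublists'] at hI
      obtain ⟨_, h3⟩ := exists_hasSliceWirtinger_expansionTerm hDo hDb hDf hf (l := l)
        (by have := hI.length_le; omega : I.length < k) fun hmem => hl (hI.subset hmem)
      exact h3.bddCont_dbar

end Expansion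

/-! ### Increasing sequences of indices -/

section Indices

variable {n : ℕ}

theorem mem_indicesBelow {i j : Fin n} : i ∈ indicesBelow j ↔ i < j := by
  unfold indicesBelow
  rw [List.mem_ofFn]
  constructor
  · rintro ⟨l, rfl⟩
    exact l.isLt
  · exact fun h => ⟨⟨i, h⟩, rfl⟩

theorem length_indicesBelow (j : Fin n) : (indicesBelow j).length = j := List.length_ofFn

theorem pairwise_indicesBelow (j : Fin n) : (indicesBelow j).Pairwise (· < ·) :=
  List.pairwise_ofFn.2 fun _ _ h => h

theorem nodup_indicesBelow (j : Fin n) : (indicesBelow j).Nodup :=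
  (pairwise_indicesBelow j).imp fun h => ne_of_lt h

theorem ofFn_eq_append_last {X : Type*} {r : ℕ} (i : Fin (r + 1) → X) :
    List.ofFn i = (List.ofFn fun a : Fin r => i a.castSucc) ++ [i (Fin.last r)] := by
  rw [List.ofFn_succ', List.concat_eq_append]

open Classical in
/-- An increasing sequence of indices amounts to its last term `j` together with a sublist of the
indices below `j`. -/
theorem sum_strictMono_eq_sum_sublists (F : List (Fin n) → Fin n → ℂ) :
    ∑ r ∈ Finset.range n, ∑ i ∈ (Finset.univ : Finset (Fin (r + 1) → Fin n)).filter StrictMono,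
      F (List.ofFn fun a : Fin r => i a.castSucc) (i (Fin.last r)) =
    ∑ j, ∑ I ∈ (indicesBelow j).sublists'.toFinset, F I j := by
  rw [Finset.sum_sigma', Finset.sum_sigma']
  refine Finset.sum_bij (fun x _ => ⟨x.2 (Fin.last x.1),
    List.ofFn fun a : Fin x.1 => x.2 a.castSucc⟩) ?_ ?_ ?_ fun _ _ => rfl
  · rintro ⟨r, i⟩ h
    simp only [Finset.mem_sigma, Finset.mem_filter, Finset.mem_univ, true_and, List.mem_toFinset,
      List.mem_sublists'] at h ⊢
    have hp : (List.ofFn fun a : Fin r => i a.castSucc).Pairwise (· < ·) :=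
      List.pairwise_ofFn.2 fun a b hab => h.2 (Fin.castSucc_lt_castSucc_iff.2 hab)
    refine List.sublist_of_subperm_of_pairwise (r := (· < ·)) (List.subperm_of_subset
      (hp.imp fun h => ne_of_lt h) fun a ha => ?_) hp (pairwise_indicesBelow _)
    obtain ⟨b, rfl⟩ := List.mem_ofFn.1 ha
    exact mem_indicesBelow.2 (h.2 (Fin.castSucc_lt_last b))
  · rintro ⟨r, i⟩ _ ⟨r', i'⟩ _ h
    simp only [Sigma.mk.injEq, heq_eq_eq] at h
    have h1 : List.ofFn i = List.ofFn i' := by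
      rw [ofFn_eq_append_last i, ofFn_eq_append_last i', h.1, h.2]
    have h2 := List.ofFn_inj'.1 h1
    obtain ⟨h3, h4⟩ := Sigma.mk.inj_iff.1 h2
    obtain rfl : r = r' := by omega
    rw [eq_of_heq h4]
  · rintro ⟨j, I⟩ h
    simp only [Finset.mem_sigma, Finset.mem_univ, true_and, List.mem_toFinset,
      List.mem_sublists'] at h
    have hI : (I ++ [j]).Pairwise (· < ·) := by
      rw [List.pairwise_append]
      exact ⟨(pairwise_indicesBelow j).sublist h, List.pairwise_singleton _ _, fun a ha b hb => by
        rw [List.mem_singleton.1 hb]; exact mem_indicesBelow.1 (h.subset ha)⟩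
    have hlen : (I ++ [j]).length = I.length + 1 := by simp
    have hr : I.length ≤ j := h.length_le.trans (length_indicesBelow j).le
    refine ⟨⟨I.length, fun a => (I ++ [j]).get (a.cast hlen.symm)⟩, ?_, ?_⟩
    · simp only [Finset.mem_sigma, Finset.mem_filter, Finset.mem_univ, true_and, Finset.mem_range]
      exact ⟨hr.trans_lt j.isLt, fun a b hab => List.pairwise_iff_get.1 hI _ _ hab⟩
    · simp only [Sigma.mk.injEq, heq_eq_eq]
      refine ⟨by simp, List.ext_getElem (by simp) fun a h1 h2 => ?_⟩
      simp

end Indices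

end

theorem mainTheorem7 (n : ℕ) (hn : 2 ≤ n) (k : ℕ) (α : ℝ) (hα : 0 < α) (hα1 : α ≤ 1)
    (D : Fin n → Set ℂ) (hDo : ∀ j, IsOpen (D j)) (hDc : ∀ j, IsConnected (D j))
    (hDb : ∀ j, Bornology.IsBounded (D j))
    (B : ∀ j, PositiveBoundary (k + 1) α (D j))
    (f : Fin n → (Fin n → ℂ) → ℂ)
    (hf : ∀ j, MemHolderSpace (n - 1) α (univ.pi D) (f j)) :
    (∀ j : Fin n,
      SolidCauchyConverges D j (iterOp (boundaryCauchy B) (indicesBelow j) (f j)) ∧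
      ∀ (l : Fin n) (L : List (Fin n)), (l :: L) <:+ indicesBelow j →
        BoundaryCauchyConverges B l (iterOp (boundaryCauchy B) L (f j))) ∧
    (∀ (r : ℕ) (i : Fin (r + 1) → Fin n), StrictMono i →
      ∀ (l : Fin n) (L : List (Fin n)), (l :: L) <:+ List.ofFn i →
        SolidCauchyConverges D l (iterOp (solidCauchy D) L (mixedDbar i f))) ∧
    ∀ z ∈ univ.pi D, solutionOpStar D f z = solutionOp B f z := by
  have hm : 1 ≤ k + 1 := by omega
  have hDf : ∀ j, volume (frontier (D j)) = 0 := fun j => (B j).volume_frontier hm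
  have hf' : ∀ j, BddContDiffOn (n - 1) (univ.pi D) (f j) := fun j => ⟨(hf j).1, (hf j).2.1⟩
  have hlen : ∀ {j : Fin n} {I : List (Fin n)}, I ∈ (indicesBelow j).sublists'.toFinset →
      I.length ≤ n - 1 := fun {j I} hI => by
    rw [List.mem_toFinset, List.mem_sublists'] at hI
    have h1 := hI.length_le
    rw [length_indicesBelow] at h1
    have := j.isLt
    omega
  have hexp : ∀ j : Fin n, EqOn (iterOp (boundaryCauchy B) (indicesBelow j) (f j))
      (fun z => ∑ I ∈ (indicesBelow j).sublists'.toFinset,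
        (-1) ^ I.length * expansionTerm D (f j) I z) (univ.pi D) := fun j =>
    iterOp_boundaryCauchy_eqOn hm hDo hDb (hf' j) (nodup_indicesBelow j) (by
      rw [length_indicesBelow]
      have := j.isLt
      omega)
  have hterm : ∀ j : Fin n, ∀ I ∈ (indicesBelow j).sublists'.toFinset,
      BddContOn (univ.pi D) (expansionTerm D (f j) I) := fun j I hI =>
    bddContOn_expansionTerm hDo hDb hDf (hf' j) (hlen hI)
  refine ⟨fun j => ⟨?_, fun l L hL => ?_⟩, fun r i hi l L _ => ?_, fun z hz => ?_⟩
  · refine BddContOn.solidCauchyConverges hDo hDb (BddContOn.congr ?_ (hexp j)) j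
    exact BddContOn.sum _ fun I hI => (hterm j I hI).const_mul _
  · have hnd : (l :: L).Nodup := (nodup_indicesBelow j).sublist hL.sublist
    have hLlen : L.length < n - 1 := by
      have h1 := hL.length_le
      rw [length_indicesBelow, List.length_cons] at h1
      have := j.isLt
      omega
    obtain ⟨a, ha⟩ := exists_hasSliceWirtinger_expansion hDo hDb hDf (hf' j) hLlen
      (List.nodup_cons.1 hnd).1
    exact boundaryCauchyConverges_congr (iterOp_boundaryCauchy_eqOn hm hDo hDb (hf' j)
      (List.nodup_cons.1 hnd).2 hLlen.le) (ha.boundaryCauchyConverges hm hDo)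
  · have hr : r + 1 ≤ n := by
      simpa using Fintype.card_le_of_injective i hi.injective
    refine BddContOn.solidCauchyConverges hDo hDb (BddContOn.iterOp_solidCauchy hDo hDb hDf ?_ L) l
    exact (BddContDiffOn.iterOp_dbar (k := 0) hDo ((hf' _).of_le (by
      rw [List.length_ofFn]; omega))).bddContOn
  · have hT : solutionOp B f z = ∑ j, ∑ I ∈ (indicesBelow j).sublists'.toFinset,
        (-1) ^ I.length * iterOp (solidCauchy D) (I ++ [j]) (iterOp dbar I (f j)) z := by
      refine Finset.sum_congr rfl fun j _ => ?_
      rw [solidCauchy_congr hDo (hexp j) j hz, solidCauchy_sum hDo hDb _ _ (hterm j) j hz]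
      refine Finset.sum_congr rfl fun I hI => ?_
      congr 1
      refine solidCauchy_iterOp_comm hDo hDb hDf (BddContDiffOn.iterOp_dbar (k := 0) hDo
        ((hf' j).of_le (by have := hlen hI; omega))).bddContOn (fun hmem => ?_) hz
      rw [List.mem_toFinset, List.mem_sublists'] at hI
      exact lt_irrefl _ (mem_indicesBelow.1 (hI.subset hmem))
    rw [hT, ← sum_strictMono_eq_sum_sublists fun I j => (-1) ^ I.length *
      iterOp (solidCauchy D) (I ++ [j]) (iterOp dbar I (f j)) z]
    unfold solutionOpStar
    refine Finset.sum_congr rfl fun r _ => ?_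
    rw [Finset.mul_sum]
    refine Finset.sum_congr rfl fun i _ => ?_
    rw [← ofFn_eq_append_last, List.length_ofFn]
    rfl
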